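/- Let $\mathbf F$ be an algebraically closed field of characteristic $p>2$, let $\mathfrak g=gl(m|n)$ be the Lie superalgebra of $(m+n)\times(m+n)$ matrices over $\mathbf F$ with matrix units $e_{ij}$, and write $\mathfrak g=\mathfrak g_{-1}\oplus\mathfrak g_{\bar 0}\oplus\mathfrak g_1$, where $\mathfrak g_{\bar 0}=gl(m)\oplus gl(n)$, $\mathfrak g_1$ is spanned by the $e_{ij}$ with $i\le m<j$ and $\mathfrak g_{-1}$ by the $e_{ji}$ with $i\le m<j$. Put $\mathfrak g^+=\mathfrak g_{\bar 0}\oplus\mathfrak g_1$, let $H$ be the space of diagonal matrices and let $\mathfrak N_0^+$ be the span of the $e_{ij}\in\mathfrak g_{\bar 0}$ with $i<j$. Let $\chi\in\mathfrak g_{\bar 0}^*$ with $\chi(\mathfrak N_0^+)=0$. For $\mathfrak s=\mathfrak g,\mathfrak g^+,\mathfrak g_{\bar 0}$ let $u(\mathfrak s,\chi)$ be the quotient of the universal enveloping superalgebra $U(\mathfrak s)$ by the two-sided ideal generated by the elements $x^p-x^{[p]}-\chi(x)^p\cdot 1$, $x\in\mathfrak s_{\bar 0}$, where $x^{[p]}$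 is the $p$-th power of the matrix $x$. Modules are $\mathbf Z_2$-graded, and a module is simple if it is nonzero and has no $\mathbf Z_2$-graded submodules other than $0$ and itself. Let $M$ be a simple $u(\mathfrak g_{\bar 0},\chi)$-module and let $v\in M$ be a maximal vector of weight $\lambda\in H^*$, that is, a nonzero homogeneous vector with $\mathfrak N_0^+v=0$ and $hv=\lambda(h)v$ for all $h\in H$. Regard $M$ as a $u(\mathfrak g^+,\chi)$-module with $\mathfrak g_1M=0$ and let $$Z^\chi(M)=u(\mathfrak g,\chi)\otimes_{u(\mathfrak g^+,\chi)}M$$ be the graded baby Verma module. Let $l=mn$, and let $e_1,\dots,e_l$ and $f_1,\dots,f_l$ be enumerations, each in any fixed order, of the basis $\{e_{ij}: i\le m<j\}$ of $\mathfrak g_1$ and of the basis $\{e_{ji}: i\le m<j\}$ of $\mathfrak g_{-1}$. Then there is a unique scalar $f_1(\lambda)\in\mathbf F$ such that $$e_1\cdots e_l\,f_1\cdots f_l\,(1\otimes v)=f_1(\lambda)\,(1\otimes v)\quad\text{in } Z^\chi(M);$$ for given $\chi$ and given enumerations it depends only on $\lambda$, and not on $M$ or $v$. Moreover, $Z^\chi(M)$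 is simple if and only if $f_1(\lambda)\neq 0$. -/

import Mathlib

open scoped TensorProduct

noncomputable section

namespace SuperGL

section Basics

variable (F : Type*) [Field F] (m n : ℕ)

/-- The underlying space of `gl(m|n)`: square matrices of size `m + n`, with rows and columns
indexed by `Fin m ⊕ Fin n` (the basis of `V = V₀ ⊕ V₁`, `dim V₀ = m`, `dim V₁ = n`). -/
abbrev Mat : Type _ := Matrix (Fin m ⊕ Fin n) (Fin m ⊕ Fin n) F

variable {m n} in
/-- The parity of a basis vector of `V = V₀ ⊕ V₁`. -/
def par : Fin m ⊕ Fin n → ZMod 2 := Sum.elim (fun _ => 0) (fun _ => 1)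

/-- The homogeneous part `gl(m|n)_i`, `i ∈ ℤ/2`: the matrices mapping `V_j` into `V_{i+j}`. -/
def part (i : ZMod 2) : Submodule F (Mat F m n) where
  carrier := {A | ∀ a b, par a ≠ i + par b → A a b = 0}
  add_mem' := by
    intro A B hA hB a b h
    simp [hA a b h, hB a b h]
  zero_mem' := by intro a b _; rfl
  smul_mem' := by
    intro c A hA a b h
    simp [hA a b h]

/-- The sign `(-1)^{ij}` for `i, j ∈ ℤ/2`. -/
def sgn (i j : ZMod 2) : F := if i = 1 ∧ j = 1 then -1 else 1

/-- The even component (the block diagonal part) of a matrix, as a linear map. -/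
def evenComp : Mat F m n →ₗ[F] Mat F m n where
  toFun A := Matrix.of fun a b => if par a = par b then A a b else 0
  map_add' A B := by ext a b; by_cases h : par a = par b <;> simp [h]
  map_smul' c A := by ext a b; by_cases h : par a = par b <;> simp [h]

variable {F m n}

theorem evenComp_apply (A : Mat F m n) (a b : Fin m ⊕ Fin n) :
    evenComp F m n A a b = if par a = par b then A a b else 0 := rfl

theorem evenComp_mem (A : Mat F m n) : evenComp F m n A ∈ part F m n 0 := by
  intro a b h
  have h' : par a ≠ par b := by simpa using h
  simp [evenComp_apply, h']

theorem par_zero_or_one (a : Fin m ⊕ Fin n) : par a = 0 ∨ par a = 1 := by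
  cases a <;> simp [par]

theorem zmod_two_cases (i : ZMod 2) : i = 0 ∨ i = 1 := by
  revert i; decide

theorem sub_evenComp_mem (A : Mat F m n) : A - evenComp F m n A ∈ part F m n 1 := by
  intro a b h
  have h' : par a = par b := by
    generalize par a = x at h ⊢
    generalize par b = y at h ⊢
    revert x y; decide
  simp [evenComp_apply, h']

theorem evenComp_of_even {A : Mat F m n} (hA : A ∈ part F m n 0) : evenComp F m n A = A := by
  ext a b
  rw [evenComp_apply]
  split_ifs with h
  · rfl
  · exact (hA a b (by simpa using h)).symm

theorem evenComp_of_odd {A : Mat F m n} (hA : A ∈ part F m n 1) : evenComp F m n A = 0 := by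
  ext a b
  rw [evenComp_apply]
  split_ifs with h
  · exact hA a b (by
      rw [h]
      generalize par b = y
      revert y; decide)
  · rfl

theorem part_mul {i j : ZMod 2} {A B : Mat F m n} (hA : A ∈ part F m n i)
    (hB : B ∈ part F m n j) : A * B ∈ part F m n (i + j) := by
  intro a b h
  rw [Matrix.mul_apply]
  refine Finset.sum_eq_zero fun c _ => ?_
  by_cases hc : par a = i + par c
  · have : par c ≠ j + par b := by
      intro h2
      exact h (by rw [hc, h2, add_assoc])
    rw [hB c b this, mul_zero]
  · rw [hA a c hc, zero_mul]

theorem part_bracket {i j : ZMod 2} {A B : Mat F m n} (hA : A ∈ part F m n i)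
    (hB : B ∈ part F m n j) : A * B - sgn F i j • (B * A) ∈ part F m n (i + j) :=
  Submodule.sub_mem _ (part_mul hA hB)
    (Submodule.smul_mem _ _ (by simpa [add_comm] using part_mul hB hA))

theorem part_pow {A : Mat F m n} (hA : A ∈ part F m n 0) (k : ℕ) : A ^ k ∈ part F m n 0 := by
  induction k with
  | zero =>
    intro a b h
    have : a ≠ b := by rintro rfl; simp at h
    simp [this]
  | succ k ih => simpa [pow_succ] using part_mul ih hA

end Basics

/-- A restricted Lie sub-superalgebra of `gl(m|n)`: a `ℤ/2`-graded subspace, closed under the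
superbracket `[x, y] = xy - (-1)^{|x||y|} yx` and, in even degree, under the `p`-mapping
`x ↦ x^p` (the `p`-th power of matrices). -/
structure RestrictedSub (F : Type*) [Field F] (m n p : ℕ) where
  carrier : Submodule F (Mat F m n)
  graded : carrier ≤ ⨆ i, carrier ⊓ part F m n i
  bracket_mem : ∀ {i j : ZMod 2} {x y : Mat F m n}, x ∈ carrier → y ∈ carrier →
    x ∈ part F m n i → y ∈ part F m n j → x * y - sgn F i j • (y * x) ∈ carrier
  pow_mem : ∀ {x : Mat F m n}, x ∈ carrier → x ∈ part F m n 0 → x ^ p ∈ carrier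

section Subs

variable (F : Type*) [Field F] (m n p : ℕ)

variable {F m n} in
theorem graded_of_evenComp {S : Submodule F (Mat F m n)}
    (h : ∀ x ∈ S, evenComp F m n x ∈ S) : S ≤ ⨆ i, S ⊓ part F m n i := by
  intro x hx
  have h0 : evenComp F m n x ∈ ⨆ i, S ⊓ part F m n i :=
    Submodule.mem_iSup_of_mem 0 ⟨h x hx, evenComp_mem x⟩
  have h1 : x - evenComp F m n x ∈ ⨆ i, S ⊓ part F m n i :=
    Submodule.mem_iSup_of_mem 1 ⟨S.sub_mem hx (h x hx), sub_evenComp_mem x⟩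
  simpa using Submodule.add_mem _ h0 h1

/-- The whole Lie superalgebra `𝔤 = gl(m|n)`. -/
def glFull : RestrictedSub F m n p where
  carrier := ⊤
  graded := graded_of_evenComp fun _ _ => trivial
  bracket_mem := fun _ _ _ _ => trivial
  pow_mem := fun _ _ => trivial

/-- The even part `𝔤₀ = gl(m) ⊕ gl(n)`. -/
def glEven : RestrictedSub F m n p where
  carrier := part F m n 0
  graded := graded_of_evenComp fun x _ => evenComp_mem x
  bracket_mem := by
    intro i j x y hx hy hi hj
    refine Submodule.sub_mem _ ?_ (Submodule.smul_mem _ _ ?_)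
    · simpa using part_mul hx hy
    · simpa using part_mul hy hx
  pow_mem := fun _ h => part_pow h p

/-- The matrices with vanishing lower left block. -/
def upperBlock : Submodule F (Mat F m n) where
  carrier := {A | ∀ (j : Fin n) (i : Fin m), A (Sum.inr j) (Sum.inl i) = 0}
  add_mem' := by intro A B hA hB j i; simp [hA j i, hB j i]
  zero_mem' := by intro j i; rfl
  smul_mem' := by intro c A hA j i; simp [hA j i]

variable {F m n} in
theorem upperBlock_mul {A B : Mat F m n} (hA : A ∈ upperBlock F m n)
    (hB : B ∈ upperBlock F m n) : A * B ∈ upperBlock F m n := by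
  intro j i
  rw [Matrix.mul_apply, Fintype.sum_sum_type]
  simp [hA j, fun k => hB k i]

variable {F m n} in
theorem upperBlock_pow {A : Mat F m n} (hA : A ∈ upperBlock F m n) (k : ℕ) :
    A ^ k ∈ upperBlock F m n := by
  induction k with
  | zero => intro j i; simp
  | succ k ih => rw [pow_succ]; exact upperBlock_mul ih hA

variable {F m n} in
theorem upperBlock_odd_mul {A B : Mat F m n} (hA : A ∈ upperBlock F m n)
    (hB : B ∈ upperBlock F m n) (hA' : A ∈ part F m n 1) (hB' : B ∈ part F m n 1) :
    A * B = 0 := by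
  ext a b
  rw [Matrix.mul_apply]
  refine Finset.sum_eq_zero fun c _ => ?_
  rcases a with a | a
  · rcases c with c | c
    · rw [hA' _ _ (by simp [par]), zero_mul]
    · rcases b with b | b
      · rw [hB c b, mul_zero]
      · rw [hB' _ _ (by simp [par]), mul_zero]
  · rcases c with c | c
    · rw [hA a c, zero_mul]
    · rw [hA' _ _ (by simp [par]), zero_mul]

/-- The subalgebra `𝔤⁺ = 𝔤₀ + 𝔤₁`, where `𝔤₁` is spanned by the `e_{ij}`, `i ≤ m < j`:
the block upper triangular matrices. -/
def glPlus : RestrictedSub F m n p where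
  carrier := upperBlock F m n
  graded := graded_of_evenComp fun x hx j i => by simp [evenComp_apply, par]
  bracket_mem := fun hx hy _ _ => Submodule.sub_mem _ (upperBlock_mul hx hy)
    (Submodule.smul_mem _ _ (upperBlock_mul hy hx))
  pow_mem := fun h _ => upperBlock_pow h p

/-- The Cartan subalgebra `H` of diagonal matrices. -/
def cartan : Submodule F (Mat F m n) where
  carrier := {A | ∀ a b, a ≠ b → A a b = 0}
  add_mem' := by intro A B hA hB a b h; simp [hA a b h, hB a b h]
  zero_mem' := by intro a b _; rfl
  smul_mem' := by intro c A hA a b h; simp [hA a b h]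

variable {F m n} in
theorem cartan_le_even {A : Mat F m n} (hA : A ∈ cartan F m n) : A ∈ part F m n 0 := by
  intro a b h
  exact hA a b (by rintro rfl; simp at h)

/-- `𝔑₀⁺`: the span of the even matrix units `e_{ij}` with `i < j`, in the usual
numbering `1, …, m + n` of the rows and columns. -/
def nilPlus : Submodule F (Mat F m n) :=
  Submodule.span F {A | ∃ a b : Fin m ⊕ Fin n, par a = par b ∧
    finSumFinEquiv a < finSumFinEquiv b ∧ A = Matrix.single a b 1}

end Subs

section Enveloping

variable {F : Type*} [Field F] {m n p : ℕ}

/-- The defining relations of `u(S, χ)` in the tensor algebra `T(S)`: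
`x y - (-1)^{|x||y|} y x = [x, y]` for homogeneous `x, y`, and
`x^p - x^{[p]} = χ(x)^p · 1` for even `x`. -/
inductive Rel (S : RestrictedSub F m n p) (χ : Module.Dual F (part F m n 0)) :
    TensorAlgebra F S.carrier → TensorAlgebra F S.carrier → Prop
  | bracket (i j : ZMod 2) (x y : S.carrier) (hx : x.1 ∈ part F m n i)
      (hy : y.1 ∈ part F m n j) :
      Rel S χ
        (TensorAlgebra.ι F x * TensorAlgebra.ι F y
          - sgn F i j • (TensorAlgebra.ι F y * TensorAlgebra.ι F x))
        (TensorAlgebra.ι F (⟨x.1 * y.1 - sgn F i j • (y.1 * x.1),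
          S.bracket_mem x.2 y.2 hx hy⟩ : S.carrier))
  | pth (x : S.carrier) (hx : x.1 ∈ part F m n 0) :
      Rel S χ
        (TensorAlgebra.ι F x ^ p
          - TensorAlgebra.ι F (⟨x.1 ^ p, S.pow_mem x.2 hx⟩ : S.carrier))
        (algebraMap F _ (χ ⟨x.1, hx⟩ ^ p))

/-- The `χ`-reduced enveloping algebra `u(S, χ)`: the quotient of the tensor algebra `T(S)` by the
two-sided ideal generated by the relations `Rel`. Equivalently `U(S)` modulo the ideal generated
by the `x^p - x^{[p]} - χ(x)^p · 1`, `x` even. -/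
def RedEnv (S : RestrictedSub F m n p) (χ : Module.Dual F (part F m n 0)) : Type _ :=
  RingQuot (Rel S χ)

instance (S : RestrictedSub F m n p) (χ : Module.Dual F (part F m n 0)) : Ring (RedEnv S χ) :=
  inferInstanceAs (Ring (RingQuot (Rel S χ)))

instance (S : RestrictedSub F m n p) (χ : Module.Dual F (part F m n 0)) :
    Algebra F (RedEnv S χ) :=
  inferInstanceAs (Algebra F (RingQuot (Rel S χ)))

namespace RedEnv

variable (S T : RestrictedSub F m n p) (χ : Module.Dual F (part F m n 0))

/-- The canonical map `S → u(S, χ)`. -/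
def ι : S.carrier →ₗ[F] RedEnv S χ :=
  (RingQuot.mkAlgHom F (Rel S χ)).toLinearMap ∘ₗ TensorAlgebra.ι F

theorem ι_bracket (i j : ZMod 2) (x y : S.carrier) (hx : x.1 ∈ part F m n i)
    (hy : y.1 ∈ part F m n j) :
    ι S χ x * ι S χ y - sgn F i j • (ι S χ y * ι S χ x)
      = ι S χ ⟨x.1 * y.1 - sgn F i j • (y.1 * x.1), S.bracket_mem x.2 y.2 hx hy⟩ := by
  have h := RingQuot.mkAlgHom_rel F (Rel.bracket (χ := χ) i j x y hx hy)
  rw [map_sub, map_smul, map_mul, map_mul] at h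
  exact h

theorem ι_pth (x : S.carrier) (hx : x.1 ∈ part F m n 0) :
    ι S χ x ^ p - ι S χ ⟨x.1 ^ p, S.pow_mem x.2 hx⟩
      = algebraMap F _ (χ ⟨x.1, hx⟩ ^ p) := by
  have h := RingQuot.mkAlgHom_rel F (Rel.pth (χ := χ) x hx)
  rw [map_sub, map_pow, AlgHom.commutes] at h
  exact h

variable {S χ} in
/-- The universal property of `u(S, χ)`. -/
def lift {A : Type*} [Ring A] [Algebra F A] (f : S.carrier →ₗ[F] A)
    (hb : ∀ (i j : ZMod 2) (x y : S.carrier) (hx : x.1 ∈ part F m n i)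
      (hy : y.1 ∈ part F m n j),
      f x * f y - sgn F i j • (f y * f x)
        = f ⟨x.1 * y.1 - sgn F i j • (y.1 * x.1), S.bracket_mem x.2 y.2 hx hy⟩)
    (hp : ∀ (x : S.carrier) (hx : x.1 ∈ part F m n 0),
      f x ^ p - f ⟨x.1 ^ p, S.pow_mem x.2 hx⟩ = algebraMap F A (χ ⟨x.1, hx⟩ ^ p)) :
    RedEnv S χ →ₐ[F] A :=
  RingQuot.liftAlgHom F ⟨TensorAlgebra.lift F f, by
    intro a b h
    cases h with
    | bracket i j x y hx hy =>
      rw [map_sub, map_smul, map_mul, map_mul]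
      simpa only [TensorAlgebra.lift_ι_apply] using hb i j x y hx hy
    | pth x hx =>
      rw [map_sub, map_pow, AlgHom.commutes]
      simpa only [TensorAlgebra.lift_ι_apply] using hp x hx⟩

theorem lift_ι {A : Type*} [Ring A] [Algebra F A] (f : S.carrier →ₗ[F] A) (hb) (hp)
    (x : S.carrier) : lift (χ := χ) f hb hp (ι S χ x) = f x := by
  unfold lift
  change RingQuot.liftAlgHom F _ (RingQuot.mkAlgHom F (Rel S χ) (TensorAlgebra.ι F x)) = f x
  rw [RingQuot.liftAlgHom_mkAlgHom_apply, TensorAlgebra.lift_ι_apply]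

variable {S T} in
/-- The homomorphism `u(S, χ) → u(T, χ)` induced by an inclusion `S ⊆ T`. -/
def incl (h : S.carrier ≤ T.carrier) : RedEnv S χ →ₐ[F] RedEnv T χ :=
  lift (ι T χ ∘ₗ Submodule.inclusion h)
    (fun i j x y hx hy =>
      ι_bracket T χ i j (Submodule.inclusion h x) (Submodule.inclusion h y) hx hy)
    (fun x hx => ι_pth T χ (Submodule.inclusion h x) hx)

/-- The products `x₁ ⋯ x_k` of homogeneous elements of `S`, of total parity `i`. -/
inductive IsMonomial : ZMod 2 → RedEnv S χ → Prop
  | one : IsMonomial 0 1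
  | mul (i j : ZMod 2) (x : S.carrier) (hx : x.1 ∈ part F m n i) (a : RedEnv S χ)
      (ha : IsMonomial j a) : IsMonomial (i + j) (ι S χ x * a)

/-- The homogeneous part of degree `i ∈ ℤ/2` of the superalgebra `u(S, χ)`. -/
def homPart (i : ZMod 2) : Submodule F (RedEnv S χ) :=
  Submodule.span F {a | IsMonomial S χ i a}

end RedEnv

variable (m n p) in
/-- The even component, as a map `𝔤⁺ → 𝔤₀`; its kernel is `𝔤₁`. -/
def plusToEven : (glPlus F m n p).carrier →ₗ[F] (glEven F m n p).carrier :=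
  LinearMap.codRestrict (part F m n 0)
    (evenComp F m n ∘ₗ (glPlus F m n p).carrier.subtype) (fun x => evenComp_mem x.1)

/-- The homomorphism `u(𝔤⁺, χ) → u(𝔤₀, χ)` which is the identity on `𝔤₀` and kills `𝔤₁`.
Through it each `u(𝔤₀, χ)`-module `M` becomes a `u(𝔤⁺, χ)`-module with `𝔤₁ M = 0`. -/
def proj (χ : Module.Dual F (part F m n 0)) :
    RedEnv (glPlus F m n p) χ →ₐ[F] RedEnv (glEven F m n p) χ :=
  RedEnv.lift (RedEnv.ι (glEven F m n p) χ ∘ₗ plusToEven m n p)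
    (by
      intro i j x y hx hy
      simp only [LinearMap.comp_apply]
      have zero_of_odd : ∀ z : (glPlus F m n p).carrier, z.1 ∈ part F m n 1 →
          plusToEven m n p z = 0 := fun z hz => Subtype.ext (evenComp_of_odd hz)
      have val_of_even : ∀ z : (glPlus F m n p).carrier, z.1 ∈ part F m n 0 →
          (plusToEven m n p z).1 = z.1 := fun z hz => evenComp_of_even hz
      have hbr : x.1 * y.1 - sgn F i j • (y.1 * x.1) ∈ part F m n (i + j) :=
        part_bracket hx hy
      rcases zmod_two_cases i with rfl | rfl <;> rcases zmod_two_cases j with rfl | rfl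
      · have h := RedEnv.ι_bracket (glEven F m n p) χ 0 0 (plusToEven m n p x)
          (plusToEven m n p y) (evenComp_mem _) (evenComp_mem _)
        rw [h]
        congr 1
        apply Subtype.ext
        refine Eq.trans ?_ (val_of_even ⟨_, (glPlus F m n p).bracket_mem x.2 y.2 hx hy⟩ hbr).symm
        simp only [val_of_even x hx, val_of_even y hy]
      · rw [zero_of_odd y hy, zero_of_odd ⟨_, (glPlus F m n p).bracket_mem x.2 y.2 hx hy⟩ hbr]
        simp
      · rw [zero_of_odd x hx, zero_of_odd ⟨_, (glPlus F m n p).bracket_mem x.2 y.2 hx hy⟩ hbr]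
        simp
      · rw [zero_of_odd x hx, zero_of_odd y hy]
        have h0 : (⟨x.1 * y.1 - sgn F 1 1 • (y.1 * x.1),
            (glPlus F m n p).bracket_mem x.2 y.2 hx hy⟩ : (glPlus F m n p).carrier) = 0 := by
          apply Subtype.ext
          have e1 := upperBlock_odd_mul x.2 y.2 hx hy
          have e2 := upperBlock_odd_mul y.2 x.2 hy hx
          simp [e1, e2]
        rw [h0]
        simp)
    (by
      intro x hx
      simp only [LinearMap.comp_apply]
      have e : (plusToEven m n p x).1 = x.1 := evenComp_of_even hx
      have h := RedEnv.ι_pth (glEven F m n p) χ (plusToEven m n p x) (evenComp_mem _)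
      have e1 : plusToEven m n p ⟨x.1 ^ p, (glPlus F m n p).pow_mem x.2 hx⟩
          = ⟨(plusToEven m n p x).1 ^ p, (glEven F m n p).pow_mem (plusToEven m n p x).2
            (evenComp_mem _)⟩ := by
        apply Subtype.ext
        change evenComp F m n (x.1 ^ p) = (plusToEven m n p x).1 ^ p
        rw [e, evenComp_of_even (part_pow hx p)]
      have e2 : (⟨(plusToEven m n p x).1, evenComp_mem _⟩ : part F m n 0) = ⟨x.1, hx⟩ :=
        Subtype.ext e
      rw [e1, h, e2])

end Enveloping

section Modules

variable {F : Type*} [Field F] {m n p : ℕ}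

/-- `gr` makes the `u(S, χ)`-module `V` a `ℤ/2`-graded module: `V = V₀ ⊕ V₁`, and `S_i V_j`
lies in `V_{i+j}`. -/
structure IsSuperModule (S : RestrictedSub F m n p) (χ : Module.Dual F (part F m n 0))
    {V : Type*} [AddCommGroup V] [Module F V] [Module (RedEnv S χ) V]
    (gr : ZMod 2 → Submodule F V) : Prop where
  internal : DirectSum.IsInternal gr
  smul_mem : ∀ (i j : ZMod 2) (x : S.carrier), x.1 ∈ part F m n i →
    ∀ w ∈ gr j, RedEnv.ι S χ x • w ∈ gr (i + j)

/-- A module `V` over an algebra `A`, with a `ℤ/2`-grading `gr`, is simple: it is nonzero, and each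
`ℤ/2`-graded submodule `N` (that is, `N = (N ∩ V₀) + (N ∩ V₁)`) is `0` or `V`. -/
def IsSimpleSuper (A : Type*) [Ring A] [Algebra F A] {V : Type*} [AddCommGroup V] [Module F V]
    [Module A V] [IsScalarTower F A V] (gr : ZMod 2 → Submodule F V) : Prop :=
  Nontrivial V ∧ ∀ N : Submodule A V,
    N.restrictScalars F = ⨆ i, N.restrictScalars F ⊓ gr i → N = ⊥ ∨ N = ⊤

/-- `v` is a maximal vector of weight `wt ∈ H*` in the `ℤ/2`-graded `u(𝔤₀, χ)`-module `V`: a nonzero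
homogeneous vector with `𝔑₀⁺ v = 0` and `h v = wt(h) v` for `h ∈ H`. -/
structure IsMaximalVector (χ : Module.Dual F (part F m n 0))
    {V : Type*} [AddCommGroup V] [Module F V] [Module (RedEnv (glEven F m n p) χ) V]
    (gr : ZMod 2 → Submodule F V) (wt : Module.Dual F (cartan F m n)) (v : V) : Prop where
  ne_zero : v ≠ 0
  homogeneous : ∃ i, v ∈ gr i
  nil_smul : ∀ x : (glEven F m n p).carrier, x.1 ∈ nilPlus F m n →
    RedEnv.ι (glEven F m n p) χ x • v = 0
  weight : ∀ h : cartan F m n,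
    RedEnv.ι (glEven F m n p) χ ⟨h.1, cartan_le_even h.2⟩ • v = wt h • v

variable (χ : Module.Dual F (part F m n 0))
  (M : Type*) [AddCommGroup M] [Module F M] [Module (RedEnv (glEven F m n p) χ) M]

/-- The relations `(a b) ⊗ w = a ⊗ (b w)`, `b ∈ u(𝔤⁺, χ)`, that cut `u(𝔤, χ) ⊗ M` (over `u(𝔤⁺, χ)`)
out of the tensor product over `F`. -/
def balance : Submodule (RedEnv (glFull F m n p) χ) (RedEnv (glFull F m n p) χ ⊗[F] M) :=
  Submodule.span _ {t | ∃ (a : RedEnv (glFull F m n p) χ) (b : RedEnv (glPlus F m n p) χ) (w : M),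
    t = (a * RedEnv.incl (S := glPlus F m n p) (T := glFull F m n p) χ le_top b) ⊗ₜ[F] w
      - a ⊗ₜ[F] (proj χ b • w)}

/-- The graded baby Verma module `Z^χ(M)`, the tensor product of `u(𝔤, χ)` and `M` over
`u(𝔤⁺, χ)`, with `u(𝔤, χ)` acting from the left on the first factor. -/
abbrev gradedBabyVerma : Type _ :=
  (RedEnv (glFull F m n p) χ ⊗[F] M) ⧸ balance χ M

variable {M} in
/-- The element `a ⊗ w` of `Z^χ(M)`. -/
def gradedBabyVerma.tmul (a : RedEnv (glFull F m n p) χ) (w : M) : gradedBabyVerma (p := p) χ M :=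
  (balance χ M).mkQ (a ⊗ₜ[F] w)

variable {M} in
/-- The `ℤ/2`-grading of `Z^χ(M)`: degree `i` is spanned by the `a ⊗ w` with `a` and `w` homogeneous
whose degrees add up to `i`. -/
def gradedBabyVerma.grading (gr : ZMod 2 → Submodule F M) (i : ZMod 2) :
    Submodule F (gradedBabyVerma (p := p) χ M) :=
  Submodule.span F {z | ∃ (j k : ZMod 2) (a : RedEnv (glFull F m n p) χ) (w : M),
    j + k = i ∧ a ∈ RedEnv.homPart (glFull F m n p) χ j ∧ w ∈ gr k ∧
      z = gradedBabyVerma.tmul χ a w}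

/-- The odd root vector `e_{ij} ∈ 𝔤₁`, from the upper right block, in `u(𝔤, χ)`. -/
def oddPos (ij : Fin m × Fin n) : RedEnv (glFull F m n p) χ :=
  RedEnv.ι (glFull F m n p) χ ⟨Matrix.single (Sum.inl ij.1) (Sum.inr ij.2) 1, trivial⟩

/-- The odd root vector `e_{ji} ∈ 𝔤₋₁`, from the lower left block, in `u(𝔤, χ)`. -/
def oddNeg (ij : Fin m × Fin n) : RedEnv (glFull F m n p) χ :=
  RedEnv.ι (glFull F m n p) χ ⟨Matrix.single (Sum.inr ij.2) (Sum.inl ij.1) 1, trivial⟩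

/-- The product `e₁ ⋯ e_l f₁ ⋯ f_l` in `u(𝔤, χ)`, `l = mn`, where `e₁, …, e_l` and `f₁, …, f_l` are
the odd root vectors of `𝔤₁` and of `𝔤₋₁`, enumerated by `s` and by `t`. -/
def oddProd (s t : Fin (m * n) ≃ Fin m × Fin n) : RedEnv (glFull F m n p) χ :=
  (List.ofFn fun k => oddPos χ (s k)).prod * (List.ofFn fun k => oddNeg χ (t k)).prod

end Modules

end SuperGL

end

open SuperGL

/-! As a vector space, `Z^χ(M)` is `Λ(𝔤₋₁) ⊗ M`. In place of a PBW theorem, the proof makes `𝔤` act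
on `Λ(𝔤₋₁) ⊗ M` directly (`exists_blockRelations`) and maps `Z^χ(M)` to this model
(`exists_verma_to_extTensor`). Three facts result: `1 ⊗ M` is a copy of `M`; there is a projection
of `Z^χ(M)` onto `M` that kills `𝔤₋₁ Z^χ(M)`; and `Φ = f₁ ⋯ f_l` acts injectively on `1 ⊗ M`.

The scalar is found inside `u(𝔤, χ)`, before any module is chosen. Modulo the left ideal generated
by the strictly upper triangular matrix units and the `h - λ(h)`, every word of matrix units of
total height zero is a scalar (`exists_scalar_of_word`). The word `e₁ ⋯ e_l f₁ ⋯ f_l` has height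
zero, and the ideal kills `1 ⊗ v`. So the scalar depends on `λ` alone, and it is unique because `1 ⊗
v ≠ 0`.

Suppose the scalar is nonzero. A nonzero graded submodule `N` contains a nonzero homogeneous vector,
which suitable `f`'s push to some `Φ ⊗ w ≠ 0` (`exists_smul_eq_prod_smul`). Elements of `𝔤₀` commute
with `Φ` up to a scalar multiple of `Φ`, so simplicity of `M` puts all of `Φ ⊗ M` in `N`. Applying
`e₁ ⋯ e_l` to `Φ ⊗ v` gives `1 ⊗ v ∈ N`, hence `N` is everything.

Suppose the scalar is zero. Then `e₁ ⋯ e_l Φ` kills all of `1 ⊗ M`. The submodule generated by `Φ ⊗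
v` is nonzero and is contained in the span of the `e_J Φ ⊗ w`, with `e_J` a word in the `e`'s
(`smul_mem_span_oddPos_words`). A word with fewer than `l` letters leaves at least one `f`, one with
`l` letters is zero or `± e₁ ⋯ e_l`, and a longer one vanishes. So the submodule lies in the kernel
of the projection to `M`, does not contain `1 ⊗ v`, and is proper. -/

noncomputable section

/-! ### Products of anticommuting elements with square zero. -/

section AnticommutingFamilies

variable {F U ι : Type*} [Field F] [Ring U] [Algebra F U] {f : ι → U}

/-- The span of the products of `k` members of the family `f`. -/
def familyPow (F : Type*) [Field F] {U ι : Type*} [Ring U] [Algebra F U] (f : ι → U) (k : ℕ) :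
    Submodule F U :=
  Submodule.span F {a | ∃ L : List ι, L.length = k ∧ a = (L.map f).prod}

theorem prod_mem_familyPow (L : List ι) : (L.map f).prod ∈ familyPow F f L.length :=
  Submodule.subset_span ⟨L, rfl, rfl⟩

theorem mul_mem_familyPow {x a : U} {k : ℕ} (hx : x ∈ Submodule.span F (Set.range f))
    (ha : a ∈ familyPow F f k) : x * a ∈ familyPow F f (k + 1) := by
  induction hx using Submodule.span_induction with
  | mem x hx =>
    obtain ⟨i, rfl⟩ := hx
    induction ha using Submodule.span_induction with
    | mem a ha =>
      obtain ⟨L, rfl, rfl⟩ := ha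
      simpa using prod_mem_familyPow (F := F) (f := f) (i :: L)
    | zero => simp
    | add a b _ _ ha hb => rw [mul_add]; exact add_mem ha hb
    | smul c a _ ha => rw [mul_smul_comm]; exact Submodule.smul_mem _ _ ha
  | zero => simp
  | add x y _ _ hx hy => rw [add_mul]; exact add_mem hx hy
  | smul c x _ hx => rw [smul_mul_assoc]; exact Submodule.smul_mem _ _ hx

/-- An element normalizing the span of a family normalizes the span of its `k`-fold products. -/
theorem commutator_prod_mem_familyPow {x : U}
    (hx : ∀ a, x * f a - f a * x ∈ Submodule.span F (Set.range f)) (L : List ι) :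
    x * (L.map f).prod - (L.map f).prod * x ∈ familyPow F f L.length := by
  induction L with
  | nil => simp
  | cons a L ih =>
    have e : x * ((a :: L).map f).prod - ((a :: L).map f).prod * x
        = (x * f a - f a * x) * (L.map f).prod
          + f a * (x * (L.map f).prod - (L.map f).prod * x) := by
      simp only [List.map_cons, List.prod_cons]; noncomm_ring
    rw [e]
    exact add_mem (mul_mem_familyPow (hx a) (prod_mem_familyPow L))
      (mul_mem_familyPow (Submodule.subset_span ⟨a, rfl⟩) ih)

/-- The factor `f a` moves past the other letters, up to sign, until it meets its own copy. -/
theorem mul_prod_eq_zero (hf : ∀ a b, f a * f b = -(f b * f a)) (hsq : ∀ a, f a * f a = 0)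
    {a : ι} {L : List ι} (ha : a ∈ L) : f a * (L.map f).prod = 0 := by
  induction L with
  | nil => simp at ha
  | cons b L ih =>
    rw [List.map_cons, List.prod_cons, ← mul_assoc]
    rcases List.mem_cons.1 ha with rfl | h
    · rw [hsq, zero_mul]
    · rw [hf, neg_mul, mul_assoc, ih h, mul_zero, neg_zero]

theorem prod_eq_zero_of_not_nodup (hf : ∀ a b, f a * f b = -(f b * f a))
    (hsq : ∀ a, f a * f a = 0) {L : List ι} (hL : ¬ L.Nodup) : (L.map f).prod = 0 := by
  induction L with
  | nil => simp at hL
  | cons b L ih =>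
    rw [List.map_cons, List.prod_cons]
    by_cases hb : b ∈ L
    · exact mul_prod_eq_zero hf hsq hb
    · rw [ih fun h => hL (List.nodup_cons.2 ⟨hb, h⟩), mul_zero]

theorem prod_eq_or_eq_neg_of_perm (hf : ∀ a b, f a * f b = -(f b * f a)) {L L' : List ι}
    (h : L.Perm L') : (L.map f).prod = (L'.map f).prod ∨ (L.map f).prod = -(L'.map f).prod := by
  induction h with
  | nil => exact Or.inl rfl
  | cons a _ ih => rcases ih with h | h <;> simp [h]
  | swap a b L =>
    right
    simp only [List.map_cons, List.prod_cons]
    rw [← mul_assoc, hf, neg_mul, mul_assoc]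
  | trans _ _ h1 h2 => rcases h1 with h1 | h1 <;> rcases h2 with h2 | h2 <;> simp [h1, h2]

/-- The top exterior power is at most a line: a word of length `l` in an alphabet of `l` letters
either repeats a letter, and vanishes, or is a permutation of the full list, and agrees with its
product up to sign. -/
theorem prod_mem_span_of_length_eq (hf : ∀ a b, f a * f b = -(f b * f a))
    (hsq : ∀ a, f a * f a = 0) {l : ℕ} (t : Fin l ≃ ι) {L : List ι} (hL : L.length = l) :
    (L.map f).prod ∈ Submodule.span F {((List.ofFn t).map f).prod} := by
  by_cases h : L.Nodup
  · have hp : L.Perm (List.ofFn t) := by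
      have hs : (List.ofFn t).Nodup := List.nodup_ofFn.2 t.injective
      refine ?_
      classical
      have := Fintype.ofEquiv _ t
      rw [List.perm_ext_iff_of_nodup h hs]
      have hu : L.toFinset = Finset.univ := by
        apply Finset.eq_univ_of_card
        rw [List.toFinset_card_of_nodup h, hL, ← Fintype.card_congr t, Fintype.card_fin]
      intro a
      have ha : a ∈ L.toFinset := hu ▸ Finset.mem_univ a
      simpa [List.mem_toFinset.1 ha, List.mem_ofFn] using t.surjective a
    rcases prod_eq_or_eq_neg_of_perm hf hp with h | h <;> rw [h]
    · exact Submodule.mem_span_singleton_self _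
    · exact neg_mem (Submodule.mem_span_singleton_self _)
  · rw [prod_eq_zero_of_not_nodup hf hsq h]; exact zero_mem _

theorem prod_eq_zero_of_lt_length (hf : ∀ a b, f a * f b = -(f b * f a))
    (hsq : ∀ a, f a * f a = 0) {l : ℕ} (t : Fin l ≃ ι) {L : List ι} (hL : l < L.length) :
    (L.map f).prod = 0 := by
  refine prod_eq_zero_of_not_nodup hf hsq fun h => ?_
  have := Fintype.ofEquiv _ t
  have h1 := h.length_le_card
  rw [← Fintype.card_congr t, Fintype.card_fin] at h1
  omega

/-- An element normalizing the span of a finite anticommuting family commutes with the product of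
the whole family up to a scalar multiple of that product. -/
theorem exists_mul_top_eq (hf : ∀ a b, f a * f b = -(f b * f a)) (hsq : ∀ a, f a * f a = 0)
    {l : ℕ} (t : Fin l ≃ ι) {x : U}
    (hx : ∀ a, x * f a - f a * x ∈ Submodule.span F (Set.range f)) :
    ∃ c : F, x * ((List.ofFn t).map f).prod
      = ((List.ofFn t).map f).prod * x + c • ((List.ofFn t).map f).prod := by
  -- The commutator is a combination of `l`-fold products, and all of these are multiples of the
  -- full product.
  have h := commutator_prod_mem_familyPow hx (List.ofFn t)
  have h2 : familyPow F f (List.ofFn t).length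
      ≤ Submodule.span F {((List.ofFn t).map f).prod} := by
    refine Submodule.span_le.2 ?_
    rintro _ ⟨L, hL, rfl⟩
    exact prod_mem_span_of_length_eq hf hsq t (by simpa using hL)
  obtain ⟨c, hc⟩ := Submodule.mem_span_singleton.1 (h2 h)
  exact ⟨c, by rw [hc]; abel⟩

end AnticommutingFamilies

/-! ### Block decomposition of `gl(m|n)`. -/

section Blocks

variable (F : Type*) [Field F] (m n : ℕ)

/-- Pairs of diagonal blocks, as a ring. -/
abbrev DiagBlocks : Type _ := Matrix (Fin m) (Fin m) F × Matrix (Fin n) (Fin n) F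

/-- The block diagonal matrix with given diagonal blocks. -/
def diagMat : DiagBlocks F m n →ₗ[F] Mat F m n where
  toFun x := Matrix.fromBlocks x.1 0 0 x.2
  map_add' x y := by simp [Matrix.fromBlocks_add]
  map_smul' c x := by simp [Matrix.fromBlocks_smul]

/-- The matrix with a given upper right block and zeros elsewhere. -/
def upMat : Matrix (Fin m) (Fin n) F →ₗ[F] Mat F m n where
  toFun b := Matrix.fromBlocks 0 b 0 0
  map_add' x y := by simp [Matrix.fromBlocks_add]
  map_smul' c x := by simp [Matrix.fromBlocks_smul]

/-- The matrix with a given lower left block and zeros elsewhere. -/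
def downMat : Matrix (Fin n) (Fin m) F →ₗ[F] Mat F m n where
  toFun c := Matrix.fromBlocks 0 0 c 0
  map_add' x y := by simp [Matrix.fromBlocks_add]
  map_smul' c x := by simp [Matrix.fromBlocks_smul]

variable {F m n}

theorem diagMat_apply (x : DiagBlocks F m n) :
    diagMat F m n x = Matrix.fromBlocks x.1 0 0 x.2 := rfl

theorem upMat_apply (b : Matrix (Fin m) (Fin n) F) :
    upMat F m n b = Matrix.fromBlocks 0 b 0 0 := rfl

theorem downMat_apply (c : Matrix (Fin n) (Fin m) F) :
    downMat F m n c = Matrix.fromBlocks 0 0 c 0 := rfl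

theorem diagMat_mem (x : DiagBlocks F m n) : diagMat F m n x ∈ part F m n 0 := by
  rintro (a | a) (b | b) h <;> simp [par, diagMat_apply] at h ⊢

theorem upMat_mem (x : Matrix (Fin m) (Fin n) F) : upMat F m n x ∈ part F m n 1 := by
  rintro (a | a) (b | b) h <;> simp [par, upMat_apply] at h ⊢
  exact absurd (by decide : (1 : ZMod 2) + 1 = 0) (fun h' => h h'.symm)

theorem downMat_mem (x : Matrix (Fin n) (Fin m) F) : downMat F m n x ∈ part F m n 1 := by
  rintro (a | a) (b | b) h <;> simp [par, downMat_apply] at h ⊢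

theorem diagMat_pow (x : DiagBlocks F m n) (k : ℕ) :
    diagMat F m n x ^ k = diagMat F m n (x ^ k) := by
  induction k with
  | zero => simp [diagMat_apply]
  | succ k ih => rw [pow_succ, ih, pow_succ]; simp [diagMat_apply, Matrix.fromBlocks_multiply]

/-- The diagonal blocks of a matrix. -/
def diagOf : Mat F m n →ₗ[F] DiagBlocks F m n where
  toFun A := (A.toBlocks₁₁, A.toBlocks₂₂)
  map_add' _ _ := rfl
  map_smul' _ _ := rfl

/-- The upper right block of a matrix. -/
def upOf : Mat F m n →ₗ[F] Matrix (Fin m) (Fin n) F where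
  toFun A := A.toBlocks₁₂
  map_add' _ _ := rfl
  map_smul' _ _ := rfl

/-- The lower left block of a matrix. -/
def downOf : Mat F m n →ₗ[F] Matrix (Fin n) (Fin m) F where
  toFun A := A.toBlocks₂₁
  map_add' _ _ := rfl
  map_smul' _ _ := rfl

theorem eq_sum_blocks (A : Mat F m n) :
    A = diagMat F m n (diagOf A) + upMat F m n (upOf A) + downMat F m n (downOf A) := by
  rw [diagMat_apply, upMat_apply, downMat_apply, Matrix.fromBlocks_add, Matrix.fromBlocks_add]
  simp only [add_zero, zero_add]
  exact (Matrix.fromBlocks_toBlocks A).symm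

theorem diagOf_of_odd {A : Mat F m n} (h : A ∈ part F m n 1) : diagOf A = 0 := by
  refine Prod.ext ?_ ?_
  · ext a b; exact h _ _ (by simp [par])
  · ext a b; exact h _ _ (by simp [par])

theorem upOf_of_even {A : Mat F m n} (h : A ∈ part F m n 0) : upOf A = 0 := by
  ext a b; exact h _ _ (by simp [par])

theorem downOf_of_even {A : Mat F m n} (h : A ∈ part F m n 0) : downOf A = 0 := by
  ext a b; exact h _ _ (by simp [par])

theorem eq_diagMat_of_even {A : Mat F m n} (h : A ∈ part F m n 0) :
    A = diagMat F m n (diagOf A) := by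
  conv_lhs => rw [eq_sum_blocks A, upOf_of_even h, downOf_of_even h]
  simp

theorem eq_of_odd {A : Mat F m n} (h : A ∈ part F m n 1) :
    A = upMat F m n (upOf A) + downMat F m n (downOf A) := by
  conv_lhs => rw [eq_sum_blocks A, diagOf_of_odd h]
  simp

/-- Three linear maps `X`, `E`, `Y` out of `𝔤₀`, `𝔤₁` and `𝔤₋₁` satisfying the relations of
`gl(m|n)`. -/
structure BlockRelations {A : Type*} [Ring A] [Algebra F A] (X : DiagBlocks F m n →ₗ[F] A)
    (E : Matrix (Fin m) (Fin n) F →ₗ[F] A) (Y : Matrix (Fin n) (Fin m) F →ₗ[F] A) : Prop where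
  diag_diag : ∀ x y, X x * X y - X y * X x = X (x * y - y * x)
  diag_up : ∀ x b, X x * E b - E b * X x = E (x.1 * b - b * x.2)
  diag_down : ∀ x c, X x * Y c - Y c * X x = Y (x.2 * c - c * x.1)
  up_down : ∀ b c, E b * Y c + Y c * E b = X (b * c, c * b)
  up_up : ∀ b b', E b * E b' + E b' * E b = 0
  down_down : ∀ c c', Y c * Y c' + Y c' * Y c = 0

end Blocks

/-! ### Block generators of the reduced enveloping algebras. -/

section Env

variable {F : Type*} [Field F] {m n p : ℕ} (χ : Module.Dual F (part F m n 0))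

/-- The even part of `u(𝔤, χ)`. -/
def envDiag : DiagBlocks F m n →ₗ[F] RedEnv (glFull F m n p) χ :=
  RedEnv.ι (glFull F m n p) χ ∘ₗ (diagMat F m n).codRestrict _ (fun _ => trivial)

/-- The image of `𝔤₁` in `u(𝔤, χ)`. -/
def envUp : Matrix (Fin m) (Fin n) F →ₗ[F] RedEnv (glFull F m n p) χ :=
  RedEnv.ι (glFull F m n p) χ ∘ₗ (upMat F m n).codRestrict _ (fun _ => trivial)

/-- The image of `𝔤₋₁` in `u(𝔤, χ)`. -/
def envDown : Matrix (Fin n) (Fin m) F →ₗ[F] RedEnv (glFull F m n p) χ :=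
  RedEnv.ι (glFull F m n p) χ ∘ₗ (downMat F m n).codRestrict _ (fun _ => trivial)

/-- The image of `𝔤₀` in `u(𝔤₀, χ)`. -/
def evenDiag : DiagBlocks F m n →ₗ[F] RedEnv (glEven F m n p) χ :=
  RedEnv.ι (glEven F m n p) χ ∘ₗ (diagMat F m n).codRestrict _ (fun x => diagMat_mem x)

theorem envDiag_apply (x : DiagBlocks F m n) : envDiag (p := p) χ x
    = RedEnv.ι (glFull F m n p) χ ⟨diagMat F m n x, trivial⟩ := rfl

theorem envUp_apply (x : Matrix (Fin m) (Fin n) F) : envUp (p := p) χ x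
    = RedEnv.ι (glFull F m n p) χ ⟨upMat F m n x, trivial⟩ := rfl

theorem envDown_apply (x : Matrix (Fin n) (Fin m) F) : envDown (p := p) χ x
    = RedEnv.ι (glFull F m n p) χ ⟨downMat F m n x, trivial⟩ := rfl

theorem evenDiag_apply (x : DiagBlocks F m n) : evenDiag (p := p) χ x
    = RedEnv.ι (glEven F m n p) χ ⟨diagMat F m n x, diagMat_mem x⟩ := rfl

theorem envι_eq (x : (glFull F m n p).carrier) :
    RedEnv.ι (glFull F m n p) χ x
      = envDiag χ (diagOf x.1) + envUp χ (upOf x.1) + envDown χ (downOf x.1) := by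
  simp only [envDiag_apply, envUp_apply, envDown_apply, ← map_add]
  congr 1
  exact Subtype.ext (eq_sum_blocks x.1)

/-- The bracket in block form is only propositionally equal to the matrix expression in
`RedEnv.ι_bracket`; naming its value `z` leaves one matrix identity to check. -/
theorem ι_bracket_of_eq (S : RestrictedSub F m n p) (i j : ZMod 2) (x y z : S.carrier)
    (hx : x.1 ∈ part F m n i) (hy : y.1 ∈ part F m n j)
    (h : x.1 * y.1 - sgn F i j • (y.1 * x.1) = z.1) :
    RedEnv.ι S χ x * RedEnv.ι S χ y - sgn F i j • (RedEnv.ι S χ y * RedEnv.ι S χ x)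
      = RedEnv.ι S χ z := by
  rw [RedEnv.ι_bracket S χ i j x y hx hy]
  congr 1
  exact Subtype.ext h

theorem sgn_zero_left (j : ZMod 2) : sgn F 0 j = 1 := by simp [sgn]

theorem sgn_zero_right (j : ZMod 2) : sgn F j 0 = 1 := by simp [sgn]

theorem sgn_one_one : sgn F 1 1 = -1 := by simp [sgn]

theorem envBlockRelations :
    BlockRelations (envDiag (p := p) χ) (envUp (p := p) χ) (envDown (p := p) χ) where
  diag_diag x y := by
    have h := ι_bracket_of_eq χ (glFull F m n p) 0 0 ⟨diagMat F m n x, trivial⟩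
      ⟨diagMat F m n y, trivial⟩ ⟨diagMat F m n (x * y - y * x), trivial⟩
      (diagMat_mem x) (diagMat_mem y)
      (by simp [diagMat_apply, Matrix.fromBlocks_multiply, sgn_zero_left, sub_eq_add_neg,
        Matrix.fromBlocks_neg, Matrix.fromBlocks_add])
    simp only [sgn_zero_left, one_smul] at h
    exact h
  diag_up x b := by
    have h := ι_bracket_of_eq χ (glFull F m n p) 0 1 ⟨diagMat F m n x, trivial⟩
      ⟨upMat F m n b, trivial⟩ ⟨upMat F m n (x.1 * b - b * x.2), trivial⟩
      (diagMat_mem x) (upMat_mem b)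
      (by simp [diagMat_apply, upMat_apply, Matrix.fromBlocks_multiply, sgn_zero_left,
        sub_eq_add_neg, Matrix.fromBlocks_neg, Matrix.fromBlocks_add])
    simp only [sgn_zero_left, one_smul] at h
    exact h
  diag_down x c := by
    have h := ι_bracket_of_eq χ (glFull F m n p) 0 1 ⟨diagMat F m n x, trivial⟩
      ⟨downMat F m n c, trivial⟩ ⟨downMat F m n (x.2 * c - c * x.1), trivial⟩
      (diagMat_mem x) (downMat_mem c)
      (by simp [diagMat_apply, downMat_apply, Matrix.fromBlocks_multiply, sgn_zero_left,
        sub_eq_add_neg, Matrix.fromBlocks_neg, Matrix.fromBlocks_add])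
    simp only [sgn_zero_left, one_smul] at h
    exact h
  up_down b c := by
    have h := ι_bracket_of_eq χ (glFull F m n p) 1 1 ⟨upMat F m n b, trivial⟩
      ⟨downMat F m n c, trivial⟩ ⟨diagMat F m n (b * c, c * b), trivial⟩
      (upMat_mem b) (downMat_mem c)
      (by simp [diagMat_apply, upMat_apply, downMat_apply, Matrix.fromBlocks_multiply,
        sgn_one_one, Matrix.fromBlocks_add])
    simp only [sgn_one_one, neg_smul, one_smul, sub_neg_eq_add] at h
    exact h
  up_up b b' := by
    have h := ι_bracket_of_eq χ (glFull F m n p) 1 1 ⟨upMat F m n b, trivial⟩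
      ⟨upMat F m n b', trivial⟩ 0
      (upMat_mem b) (upMat_mem b')
      (by simp [upMat_apply, Matrix.fromBlocks_multiply, sgn_one_one])
    simp only [sgn_one_one, neg_smul, one_smul, sub_neg_eq_add, map_zero] at h
    exact h
  down_down b b' := by
    have h := ι_bracket_of_eq χ (glFull F m n p) 1 1 ⟨downMat F m n b, trivial⟩
      ⟨downMat F m n b', trivial⟩ 0
      (downMat_mem b) (downMat_mem b')
      (by simp [downMat_apply, Matrix.fromBlocks_multiply, sgn_one_one])
    simp only [sgn_one_one, neg_smul, one_smul, sub_neg_eq_add, map_zero] at h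
    exact h

theorem evenDiag_bracket (x y : DiagBlocks F m n) :
    evenDiag (p := p) χ x * evenDiag χ y - evenDiag χ y * evenDiag χ x
      = evenDiag χ (x * y - y * x) := by
  have h := ι_bracket_of_eq χ (glEven F m n p) 0 0 ⟨diagMat F m n x, diagMat_mem x⟩
    ⟨diagMat F m n y, diagMat_mem y⟩ ⟨diagMat F m n (x * y - y * x), diagMat_mem _⟩
    (diagMat_mem x) (diagMat_mem y)
    (by simp [diagMat_apply, Matrix.fromBlocks_multiply, sgn_zero_left, sub_eq_add_neg,
      Matrix.fromBlocks_neg, Matrix.fromBlocks_add])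
  simp only [sgn_zero_left, one_smul] at h
  exact h

theorem evenDiag_pth (x : DiagBlocks F m n) :
    evenDiag (p := p) χ x ^ p - evenDiag χ (x ^ p)
      = algebraMap F _ (χ ⟨diagMat F m n x, diagMat_mem x⟩ ^ p) := by
  rw [← RedEnv.ι_pth (glEven F m n p) χ ⟨diagMat F m n x, diagMat_mem x⟩ (diagMat_mem x)]
  refine congrArg (fun z => _ - RedEnv.ι (glEven F m n p) χ z) ?_
  exact Subtype.ext (diagMat_pow x p).symm

/-- Induction on the tensor algebra descends along the surjection onto its quotient. -/
theorem RedEnv.induction (S : RestrictedSub F m n p) {P : RedEnv S χ → Prop}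
    (algebraMap : ∀ c : F, P (algebraMap F _ c))
    (ι : ∀ x, P (RedEnv.ι S χ x)) (mul : ∀ a b, P a → P b → P (a * b))
    (add : ∀ a b, P a → P b → P (a + b)) (a : RedEnv S χ) : P a := by
  obtain ⟨a, rfl⟩ : ∃ b, RingQuot.mkAlgHom F (Rel S χ) b = a :=
    RingQuot.mkAlgHom_surjective F (Rel S χ) a
  induction a using TensorAlgebra.induction with
  | algebraMap c => rw [AlgHom.commutes]; exact algebraMap c
  | ι x => exact ι x
  | mul a b ha hb => rw [map_mul]; exact mul _ _ ha hb
  | add a b ha hb => rw [map_add]; exact add _ _ ha hb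

/-- Every subspace of a module stable under the generators of `u(S, χ)` is a submodule. -/
theorem RedEnv.smul_mem_of_ι (S : RestrictedSub F m n p) {V : Type*} [AddCommGroup V] [Module F V]
    [Module (RedEnv S χ) V] [IsScalarTower F (RedEnv S χ) V] (W : Submodule F V)
    (h : ∀ x, ∀ w ∈ W, RedEnv.ι S χ x • w ∈ W) (a : RedEnv S χ) : ∀ w ∈ W, a • w ∈ W := by
  induction a using RedEnv.induction with
  | algebraMap c => intro w hw; rw [algebraMap_smul]; exact W.smul_mem c hw
  | ι x => exact h x
  | mul a b ha hb => intro w hw; rw [mul_smul]; exact ha _ (hb _ hw)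
  | add a b ha hb => intro w hw; rw [add_smul]; exact add_mem (ha _ hw) (hb _ hw)

end Env

/-! ### Operators on `Λ(V) ⊗ M` determined by their supercommutators with `V`. -/

section ExteriorOperators

/-- The space `Λ(V) ⊗ M`. -/
def ExtTensor (F V M : Type*) [Field F] [AddCommGroup V] [Module F V] [AddCommGroup M]
    [Module F M] : Type _ := ExteriorAlgebra F V ⊗[F] M

variable (F : Type*) [Field F] (V : Type*) [AddCommGroup V] [Module F V]
  (M : Type*) [AddCommGroup M] [Module F M]

instance : AddCommGroup (ExtTensor F V M) :=
  inferInstanceAs (AddCommGroup (ExteriorAlgebra F V ⊗[F] M))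

instance : Module F (ExtTensor F V M) := inferInstanceAs (Module F (ExteriorAlgebra F V ⊗[F] M))

/-- The bilinear map `(x, w) ↦ x ⊗ w`. -/
def extTmul : ExteriorAlgebra F V →ₗ[F] M →ₗ[F] ExtTensor F V M :=
  TensorProduct.mk F (ExteriorAlgebra F V) M

variable {F V M}

/-- The linear map on `Λ(V) ⊗ M` given by a bilinear map. -/
def extLift {N : Type*} [AddCommGroup N] [Module F N] (g : ExteriorAlgebra F V →ₗ[F] M →ₗ[F] N) :
    ExtTensor F V M →ₗ[F] N :=
  TensorProduct.lift g

theorem extLift_extTmul {N : Type*} [AddCommGroup N] [Module F N]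
    (g : ExteriorAlgebra F V →ₗ[F] M →ₗ[F] N) (x w) : extLift g (extTmul F V M x w) = g x w :=
  TensorProduct.lift.tmul x w

theorem extTensor_hom_ext {N : Type*} [AddCommGroup N] [Module F N]
    {T T' : ExtTensor F V M →ₗ[F] N} (h : ∀ x w, T (extTmul F V M x w) = T' (extTmul F V M x w)) :
    T = T' :=
  TensorProduct.ext' h

variable (M) in
/-- Left multiplication by vectors on `Λ(V) ⊗ M`. -/
def extMul : V →ₗ[F] Module.End F (ExtTensor F V M) where
  toFun c := extLift ((extTmul F V M).comp (LinearMap.mul F _ (ExteriorAlgebra.ι F c)))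
  map_add' c c' := extTensor_hom_ext fun x w => by
    simp [extLift_extTmul]
  map_smul' c c' := extTensor_hom_ext fun x w => by
    simp [extLift_extTmul]

theorem extMul_extTmul (c : V) (x : ExteriorAlgebra F V) (w : M) :
    extMul M c (extTmul F V M x w) = extTmul F V M (ExteriorAlgebra.ι F c * x) w := by
  simp [extMul, extLift_extTmul]

theorem extMul_mul_self (c : V) : extMul (F := F) M c * extMul M c = 0 := by
  refine extTensor_hom_ext fun x w => ?_
  rw [Module.End.mul_apply, extMul_extTmul, extMul_extTmul, ← mul_assoc,
    ExteriorAlgebra.ι_sq_zero, zero_mul, map_zero]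
  rfl

theorem extMul_anticomm (c c' : V) :
    extMul (F := F) M c * extMul M c' + extMul M c' * extMul M c = 0 := by
  refine extTensor_hom_ext fun x w => ?_
  rw [LinearMap.add_apply, Module.End.mul_apply, Module.End.mul_apply, extMul_extTmul,
    extMul_extTmul, extMul_extTmul, extMul_extTmul, ← LinearMap.add_apply, ← map_add,
    ← mul_assoc, ← mul_assoc, ← add_mul, ExteriorAlgebra.ι_add_mul_swap, zero_mul, map_zero]
  rfl

/-- An operator on `Λ(V) ⊗ M` that commutes with `V` up to a scalar and kills `1 ⊗ M` is zero. -/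
theorem extOp_eq_zero {T : Module.End F (ExtTensor F V M)} (ε : F)
    (h1 : ∀ w, T (extTmul F V M 1 w) = 0) (h2 : ∀ c, T * extMul M c = ε • (extMul M c * T)) :
    T = 0 := by
  refine extTensor_hom_ext fun x w => ?_
  rw [LinearMap.zero_apply]
  induction x using CliffordAlgebra.left_induction with
  | algebraMap r =>
    have e : algebraMap F (ExteriorAlgebra F V) r = r • 1 := Algebra.algebraMap_eq_smul_one r
    have h := h1 (r • w)
    rw [map_smul] at h
    rw [← h]
    change T (extTmul F V M (algebraMap F (ExteriorAlgebra F V) r) w) = _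
    rw [e, map_smul, LinearMap.smul_apply]
  | add x y hx hy => rw [map_add, LinearMap.add_apply, map_add, hx, hy, add_zero]
  | ι_mul x c hx =>
    have h := LinearMap.congr_fun (h2 c) (extTmul F V M x w)
    rw [LinearMap.smul_apply, Module.End.mul_apply, Module.End.mul_apply, hx, map_zero,
      smul_zero, extMul_extTmul] at h
    exact h

/-- The uniqueness half matching `exists_extOp`: the difference has zero supercommutator with `V`
and kills `1 ⊗ M`. Every relation in the model is verified this way, by comparing values on `1 ⊗ M`
and supercommutators with vectors. -/
theorem extOp_eq {T T' : Module.End F (ExtTensor F V M)} (ε : F)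
    {θ : V → Module.End F (ExtTensor F V M)}
    (h1 : ∀ w, T (extTmul F V M 1 w) = T' (extTmul F V M 1 w))
    (h2 : ∀ c, T * extMul M c = ε • (extMul M c * T) + θ c)
    (h3 : ∀ c, T' * extMul M c = ε • (extMul M c * T') + θ c) : T = T' := by
  refine sub_eq_zero.1 (extOp_eq_zero ε (fun w => ?_) fun c => ?_)
  · rw [LinearMap.sub_apply, h1, sub_self]
  · rw [sub_mul, h2, h3, mul_sub, smul_sub]; abel

/-- Operators on `Λ(V) ⊗ M` with prescribed supercommutators with `V` and prescribed values on
`1 ⊗ M`. -/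
theorem exists_extOp (ε : F) (θ : V →ₗ[F] Module.End F (ExtTensor F V M))
    (t : M →ₗ[F] ExtTensor F V M)
    (h : ∀ c, θ c * extMul M c + ε • (extMul M c * θ c) = 0) :
    ∃ T : Module.End F (ExtTensor F V M), (∀ w, T (extTmul F V M 1 w) = t w) ∧
      ∀ c, T * extMul M c = ε • (extMul M c * T) + θ c := by
  -- Here `φ` in `(x, φ)` stands for `w ↦ T (x ⊗ w)`, and `f c` returns `w ↦ T (c x ⊗ w)` as forced
  -- by the required commutation rule.
  let f : V →ₗ[F] ExteriorAlgebra F V × (M →ₗ[F] ExtTensor F V M) →ₗ[F]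
      (M →ₗ[F] ExtTensor F V M) :=
    LinearMap.mk₂ F (fun c y => θ c ∘ₗ extTmul F V M y.1 + ε • (extMul M c ∘ₗ y.2))
      (by intro c c' y; ext w; simp; abel) (by intro r c y; ext w; simp [smul_comm ε r])
      (by intro c y y'; ext w; simp; abel)
      (by intro r c y; ext w; simp [smul_comm ε r])
  -- Well-definedness of the recursion on `Λ(V)`: inserting `c` twice must give zero. The two terms
  -- with `θ c` cancel by `h`, and the term with `φ` vanishes because `c ∧ c = 0`.
  have hf : ∀ c x φ, f c (ExteriorAlgebra.ι F c * x, f c (x, φ))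
      = (0 : QuadraticForm F V) c • φ := by
    intro c x φ
    ext w
    have h1 := LinearMap.congr_fun (h c) (extTmul F V M x w)
    have h2 := LinearMap.congr_fun (extMul_mul_self (F := F) (M := M) c) (φ w)
    rw [LinearMap.add_apply, LinearMap.smul_apply, Module.End.mul_apply, Module.End.mul_apply,
      extMul_extTmul, LinearMap.zero_apply] at h1
    rw [Module.End.mul_apply, LinearMap.zero_apply] at h2
    simp only [f, LinearMap.mk₂_apply, LinearMap.add_apply, LinearMap.comp_apply,
      LinearMap.smul_apply, map_add, map_smul, h2, smul_zero, add_zero]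
    rw [zero_apply, zero_smul]
    exact h1
  let g : ExteriorAlgebra F V →ₗ[F] (M →ₗ[F] ExtTensor F V M) :=
    CliffordAlgebra.foldr' 0 f hf t
  refine ⟨extLift g, fun w => ?_, fun c => ?_⟩
  · have h1 : g 1 = t := by
      have := CliffordAlgebra.foldr'_algebraMap 0 f hf t 1
      rwa [map_one, one_smul] at this
    rw [extLift_extTmul, h1]
  · refine extTensor_hom_ext fun x w => ?_
    rw [Module.End.mul_apply, extMul_extTmul, extLift_extTmul, LinearMap.add_apply,
      LinearMap.smul_apply, Module.End.mul_apply, extLift_extTmul]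
    have h1 : g (ExteriorAlgebra.ι F c * x) = f c (x, g x) :=
      CliffordAlgebra.foldr'_ι_mul 0 f hf t c x
    rw [h1, add_comm]
    rfl

end ExteriorOperators

/-! ### Commutators and `p`-th powers in characteristic `p`. -/

section CommutatorPower

variable (p : ℕ) [Fact p.Prime]

theorem sub_pow_of_commute_of_charP (F : Type*) [Field F] [CharP F p]
    {A : Type*} [Ring A] [Algebra F A] {a b : A} (h : Commute a b) :
    (a - b) ^ p = a ^ p - b ^ p := by
  rcases subsingleton_or_nontrivial A with hA | hA
  · exact Subsingleton.elim _ _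
  · have : CharP A p := charP_of_injective_algebraMap (algebraMap F A).injective p
    exact sub_pow_char_of_commute p h

/-- In characteristic `p`, the `p`-th power of a commutator operator. -/
theorem pow_mul_sub_mul_pow_of_intertwine (F : Type*) [Field F] [CharP F p]
    {A : Type*} [Ring A] [Algebra F A]
    {V : Type*} [AddCommGroup V] [Module F V] (ξ : V →ₗ[F] A) (a : A) (D : Module.End F V)
    (h : ∀ c, a * ξ c - ξ c * a = ξ (D c)) (c : V) :
    a ^ p * ξ c - ξ c * a ^ p = ξ ((D ^ p) c) := by
  have h1 : ∀ k c, ((LinearMap.mulLeft F a - LinearMap.mulRight F a) ^ k) (ξ c)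
      = ξ ((D ^ k) c) := by
    intro k
    induction k with
    | zero => intro c; simp
    | succ k ih =>
      intro c
      rw [pow_succ, pow_succ, Module.End.mul_apply, Module.End.mul_apply, ← ih]
      congr 1
      exact h c
  -- Left and right multiplication by `a` commute, so the `p`-th power of their difference is the
  -- difference of multiplications by `a ^ p`.
  rw [← h1, sub_pow_of_commute_of_charP p F (LinearMap.commute_mulLeft_right a a),
    LinearMap.pow_mulLeft, LinearMap.pow_mulRight]
  rfl

end CommutatorPower

/-! ### The `gl(m|n)`-module structure on `Λ(𝔤₋₁) ⊗ M`. -/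

section Model

variable {F : Type*} [Field F] {m n : ℕ} {M : Type*} [AddCommGroup M] [Module F M]

/-- The action of `𝔤₀` on `𝔤₋₁`. -/
def adDown (x : DiagBlocks F m n) : Module.End F (Matrix (Fin n) (Fin m) F) where
  toFun c := x.2 * c - c * x.1
  map_add' c c' := by rw [Matrix.mul_add, Matrix.add_mul]; abel
  map_smul' r c := by simp [smul_sub]

theorem adDown_apply (x : DiagBlocks F m n) (c) : adDown x c = x.2 * c - c * x.1 := rfl

/-- The adjoint action is restricted. This is what carries the `p`-th power relation from `M` to
`Λ(𝔤₋₁) ⊗ M`. -/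
theorem adDown_pow (p : ℕ) [Fact p.Prime] [CharP F p] (x : DiagBlocks F m n) :
    adDown x ^ p = adDown (x ^ p) := by
  let L : Module.End F (Matrix (Fin n) (Fin m) F) :=
    { toFun := fun c => x.2 * c
      map_add' := fun c c' => Matrix.mul_add _ _ _
      map_smul' := fun r c => by simp }
  let R : Module.End F (Matrix (Fin n) (Fin m) F) :=
    { toFun := fun c => c * x.1
      map_add' := fun c c' => Matrix.add_mul _ _ _
      map_smul' := fun r c => by simp }
  have hLR : Commute L R := LinearMap.ext fun c => (Matrix.mul_assoc x.2 c x.1).symm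
  have e : adDown x = L - R := rfl
  have hL : ∀ k c, (L ^ k) c = x.2 ^ k * c := by
    intro k
    induction k with
    | zero => intro c; simp
    | succ k ih => intro c; rw [pow_succ, Module.End.mul_apply, ih, pow_succ, Matrix.mul_assoc]; rfl
  have hR : ∀ k c, (R ^ k) c = c * x.1 ^ k := by
    intro k
    induction k with
    | zero => intro c; simp
    | succ k ih =>
      intro c
      rw [pow_succ, Module.End.mul_apply, ih, pow_succ', ← Matrix.mul_assoc]; rfl
  rw [e, sub_pow_of_commute_of_charP p F hLR]
  ext1 c
  rw [LinearMap.sub_apply, hL, hR, adDown_apply]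
  rfl

/-- An even `x` acts as a derivation extending `adDown x` on `Λ(𝔤₋₁)` together with `σ x` on `M`.
Each operator comes from `exists_extOp` with `ε = 1`; linearity in `x` follows from uniqueness. -/
theorem exists_extDiag (σ : DiagBlocks F m n →ₗ[F] Module.End F M) :
    ∃ X : DiagBlocks F m n →ₗ[F] Module.End F (ExtTensor F (Matrix (Fin n) (Fin m) F) M),
      (∀ x w, X x (extTmul F _ M 1 w) = extTmul F _ M 1 (σ x w)) ∧
      ∀ x (c : Matrix (Fin n) (Fin m) F), X x * extMul M c = extMul M c * X x + extMul M (x.2 * c - c * x.1) := by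
  have h : ∀ x : DiagBlocks F m n, ∃ T : Module.End F (ExtTensor F (Matrix (Fin n) (Fin m) F) M),
      (∀ w, T (extTmul F _ M 1 w) = extTmul F _ M 1 (σ x w)) ∧
      ∀ c, T * extMul M c = (1 : F) • (extMul M c * T) + extMul M (adDown x c) := fun x =>
    exists_extOp 1 (extMul M ∘ₗ adDown x) (extTmul F _ M 1 ∘ₗ σ x)
      (fun c => by rw [one_smul]; exact extMul_anticomm _ _)
  choose T h1 h2 using h
  refine ⟨{ toFun := T, map_add' := fun x y => ?_, map_smul' := fun r x => ?_ }, h1, ?_⟩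
  · refine extOp_eq 1 (fun w => ?_) (h2 _) fun c => ?_
    · simp [h1]
    · have e : adDown (x + y) c = adDown x c + adDown y c := by
        simp only [adDown_apply, Prod.fst_add, Prod.snd_add, Matrix.add_mul,
          Matrix.mul_add]; abel
      simp only [add_mul, mul_add, h2, e, map_add, one_smul]; abel
  · refine extOp_eq 1 (fun w => ?_) (h2 _) fun c => ?_
    · simp [h1]
    · have e : adDown (r • x) c = r • adDown x c := by
        simp [adDown_apply, smul_sub]
      simp only [RingHom.id_apply, smul_mul_assoc, mul_smul_comm, h2, e, map_smul, one_smul,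
        smul_add]
  · intro x c
    have := h2 x c
    rwa [one_smul] at this

/-- The action of `𝔤₁` is forced by `𝔤₁ (1 ⊗ M) = 0` and by `[b, c] = (b c, c b)`, an
anticommutator, whence `ε = -1`. -/
theorem exists_extUp {X : DiagBlocks F m n →ₗ[F]
      Module.End F (ExtTensor F (Matrix (Fin n) (Fin m) F) M)}
    (hX : ∀ x (c : Matrix (Fin n) (Fin m) F), X x * extMul M c = extMul M c * X x + extMul M (x.2 * c - c * x.1)) :
    ∃ E : Matrix (Fin m) (Fin n) F →ₗ[F]
        Module.End F (ExtTensor F (Matrix (Fin n) (Fin m) F) M),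
      (∀ b w, E b (extTmul F _ M 1 w) = 0) ∧
      ∀ b c, E b * extMul M c = -(extMul M c * E b) + X (b * c, c * b) := by
  have h : ∀ b : Matrix (Fin m) (Fin n) F,
      ∃ T : Module.End F (ExtTensor F (Matrix (Fin n) (Fin m) F) M),
      (∀ w, T (extTmul F _ M 1 w) = 0) ∧
      ∀ c, T * extMul M c = (-1 : F) • (extMul M c * T) + X (b * c, c * b) := fun b =>
    exists_extOp (-1)
      { toFun := fun c => X (b * c, c * b)
        map_add' := fun c c' => by rw [← map_add, Matrix.mul_add, Matrix.add_mul]; rfl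
        map_smul' := fun r c => by rw [RingHom.id_apply, ← map_smul]; simp } 0
      -- Consistency amounts to `[[b, c], c] = 0`, that is `(c b) c - c (b c) = 0`.
      (fun c => by
        simp only [LinearMap.coe_mk, AddHom.coe_mk]
        rw [hX, Matrix.mul_assoc, sub_self, map_zero, add_zero, neg_one_smul, add_neg_cancel])
  choose T h1 h2 using h
  refine ⟨{ toFun := T, map_add' := fun x y => ?_, map_smul' := fun r x => ?_ }, h1, ?_⟩
  · refine extOp_eq (-1) (fun w => ?_) (h2 _) fun c => ?_
    · simp [h1]
    · have e : X ((x + y) * c, c * (x + y)) = X (x * c, c * x) + X (y * c, c * y) := by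
        rw [← map_add, Matrix.mul_add, Matrix.add_mul]; rfl
      simp only [add_mul, mul_add, h2, e, smul_add]; abel
  · refine extOp_eq (-1) (fun w => ?_) (h2 _) fun c => ?_
    · simp [h1]
    · have e : X ((r • x) * c, c * (r • x)) = r • X (x * c, c * x) := by
        rw [← map_smul]; simp
      simp only [RingHom.id_apply, smul_mul_assoc, mul_smul_comm, h2, e, smul_add,
        smul_comm r (-1 : F)]
  · intro x c
    have := h2 x c
    rwa [neg_one_smul] at this

theorem extOp_eq_one {V : Type*} [AddCommGroup V] [Module F V]
    {T T' : Module.End F (ExtTensor F V M)} {θ : V → Module.End F (ExtTensor F V M)}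
    (h1 : ∀ w, T (extTmul F V M 1 w) = T' (extTmul F V M 1 w))
    (h2 : ∀ c, T * extMul M c = extMul M c * T + θ c)
    (h3 : ∀ c, T' * extMul M c = extMul M c * T' + θ c) : T = T' :=
  extOp_eq 1 h1 (by simpa using h2) (by simpa using h3)

theorem extOp_eq_neg_one {V : Type*} [AddCommGroup V] [Module F V]
    {T T' : Module.End F (ExtTensor F V M)} {θ : V → Module.End F (ExtTensor F V M)}
    (h1 : ∀ w, T (extTmul F V M 1 w) = T' (extTmul F V M 1 w))
    (h2 : ∀ c, T * extMul M c = -(extMul M c * T) + θ c)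
    (h3 : ∀ c, T' * extMul M c = -(extMul M c * T') + θ c) : T = T' :=
  extOp_eq (-1) h1 (by simpa using h2) (by simpa using h3)

/-- Commutation rules of a product, for operators commuting with `q` up to correction terms. -/
theorem mul_mul_eq_of_comm {A : Type*} [Ring A] {a b q u v w : A} (ha : a * q = q * a + u)
    (hb : b * q = q * b + v) (hv : a * v = v * a + w) :
    a * b * q = q * (a * b) + (u * b + v * a + w) := by
  rw [mul_assoc, hb, mul_add, ← mul_assoc, ha, add_mul, hv]; noncomm_ring

/-- The `𝔤`-module structure on `Λ(𝔤₋₁) ⊗ M` induced from the action of `𝔤₀` on `M`. -/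
theorem exists_blockRelations (p : ℕ) [Fact p.Prime] [CharP F p]
    (σ : DiagBlocks F m n →ₗ[F] Module.End F M) (κ : DiagBlocks F m n → F)
    (hσ : ∀ x y, σ x * σ y - σ y * σ x = σ (x * y - y * x))
    (hp : ∀ x, σ x ^ p - σ (x ^ p) = algebraMap F _ (κ x)) :
    ∃ X E, BlockRelations X E (extMul (F := F) (V := Matrix (Fin n) (Fin m) F) M) ∧
      (∀ x, X x ^ p - X (x ^ p) = algebraMap F _ (κ x)) ∧
      (∀ x w, X x (extTmul F _ M 1 w) = extTmul F _ M 1 (σ x w)) ∧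
      (∀ b w, E b (extTmul F _ M 1 w) = 0) := by
  obtain ⟨X, X1, X2⟩ := exists_extDiag (m := m) (n := n) σ
  obtain ⟨E, E1, E2⟩ := exists_extUp X2
  have XX : ∀ x y, X x * X y - X y * X x = X (x * y - y * x) := by
    intro x y
    refine extOp_eq_one (fun w => ?_) (fun c => ?_) (X2 _)
    · simp only [LinearMap.sub_apply, Module.End.mul_apply, X1, ← map_sub]
      rw [← hσ]; rfl
    · have h1 := mul_mul_eq_of_comm (X2 x c) (X2 y c) (X2 x _)
      have h2 := mul_mul_eq_of_comm (X2 y c) (X2 x c) (X2 y _)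
      rw [sub_mul, h1, h2]
      have e : (x * y - y * x).2 * c - c * (x * y - y * x).1
          = (x.2 * (y.2 * c - c * y.1) - (y.2 * c - c * y.1) * x.1)
            - (y.2 * (x.2 * c - c * x.1) - (x.2 * c - c * x.1) * y.1) := by
        simp only [Prod.snd_sub, Prod.fst_sub, Prod.snd_mul, Prod.fst_mul, Matrix.mul_sub,
          Matrix.sub_mul, Matrix.mul_assoc]
        abel
      rw [e, map_sub (extMul M) (_ - _) (_ - _), mul_sub]
      abel
  have XE : ∀ x b, X x * E b - E b * X x = E (x.1 * b - b * x.2) := by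
    intro x b
    refine extOp_eq_neg_one (fun w => ?_) (fun c => ?_) (E2 _)
    · simp [X1, E1]
    · have hXX := XX x (b * c, c * b)
      have h1 : X x * E b * extMul M c = -(extMul M c * (X x * E b))
          - extMul M (x.2 * c - c * x.1) * E b + X x * X (b * c, c * b) := by
        rw [mul_assoc, E2, mul_add, mul_neg, ← mul_assoc, X2]; noncomm_ring
      have h2 : E b * X x * extMul M c = -(extMul M c * (E b * X x)) + X (b * c, c * b) * X x
          - extMul M (x.2 * c - c * x.1) * E b
          + X (b * (x.2 * c - c * x.1), (x.2 * c - c * x.1) * b) := by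
        rw [mul_assoc, X2, mul_add, ← mul_assoc, E2, E2]; noncomm_ring
      have e : ((x.1 * b - b * x.2) * c, c * (x.1 * b - b * x.2))
          = (x * (b * c, c * b) - (b * c, c * b) * x : DiagBlocks F m n)
            - (b * (x.2 * c - c * x.1), (x.2 * c - c * x.1) * b) := by
        refine Prod.ext ?_ ?_ <;>
        simp only [Prod.snd_sub, Prod.fst_sub, Prod.snd_mul, Prod.fst_mul, Matrix.mul_sub,
          Matrix.sub_mul, Matrix.mul_assoc] <;> abel
      rw [sub_mul, h1, h2, e, map_sub X (_ - _), ← hXX, mul_sub]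
      abel
  refine ⟨X, E, ⟨XX, XE, fun x c => ?_, fun b c => ?_, fun b b' => ?_, extMul_anticomm⟩,
    fun x => ?_, X1, E1⟩
  · rw [X2]; abel
  · rw [E2]; abel
  · refine extOp_eq_one (θ := fun _ => 0) (fun w => ?_) (fun c => ?_) (fun c => by simp)
    · simp [E1]
    -- After symmetrizing in `b` and `b'` the terms in `X` cancel in pairs, and the terms in `E`
    -- cancel because `b' c b - b c b'` is antisymmetric.
    · have h : ∀ b b' : Matrix (Fin m) (Fin n) F, E b * E b' * extMul M c
          = extMul M c * (E b * E b') - X (b * c, c * b) * E b'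
            + X (b' * c, c * b') * E b - E (b' * c * b - b * (c * b')) := by
        intro b b'
        have := XE (b' * c, c * b') b
        rw [← this, mul_assoc, E2, mul_add, mul_neg, ← mul_assoc, E2]; noncomm_ring
      rw [add_mul, h, h]
      have e : b * c * b' - b' * (c * b) = -(b' * c * b - b * (c * b')) := by
        simp only [Matrix.mul_assoc]; abel
      rw [e, map_neg, mul_add]
      abel
  -- Both `X x ^ p` and `X (x ^ p)` have commutator `adDown (x ^ p)` with `𝔤₋₁`. Their difference
  -- therefore commutes with `𝔤₋₁` and is determined by its value on `1 ⊗ M`, which is the scalar `κ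
  -- x`.
  · have h1 := pow_mul_sub_mul_pow_of_intertwine p F (extMul M) (X x) (adDown x)
      (fun c => by rw [X2, adDown_apply]; abel)
    rw [adDown_pow p x] at h1
    refine extOp_eq_one (θ := fun _ => 0) (fun w => ?_) (fun c => ?_) (fun c => ?_)
    · have hk : ∀ k w, (X x ^ k) (extTmul F _ M 1 w) = extTmul F _ M 1 ((σ x ^ k) w) := by
        intro k
        induction k with
        | zero => intro w; simp
        | succ k ih =>
          intro w
          rw [pow_succ, pow_succ, Module.End.mul_apply, Module.End.mul_apply, X1, ih]
      rw [LinearMap.sub_apply, hk, X1, ← map_sub, ← LinearMap.sub_apply, hp,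
        Module.algebraMap_end_apply, Module.algebraMap_end_apply, map_smul]
    · have h2 := X2 (x ^ p) c
      have h3 := h1 c
      rw [adDown_apply, sub_eq_iff_eq_add] at h3
      rw [sub_mul, h3, h2, mul_sub]; abel
    · rw [add_zero]; exact Algebra.commutes _ _

end Model

/-! ### The module `Z^χ(M)` and its comparison with `Λ(𝔤₋₁) ⊗ M`. -/

section BabyVerma

variable {F : Type*} [Field F] {m n p : ℕ} (χ : Module.Dual F (part F m n 0))
  {M : Type*} [AddCommGroup M] [Module F M] [Module (RedEnv (glEven F m n p) χ) M]

/-- The embedding `w ↦ 1 ⊗ w` of `M` into `Z^χ(M)`. -/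
def verma : M →ₗ[F] gradedBabyVerma (p := p) χ M where
  toFun w := gradedBabyVerma.tmul χ 1 w
  map_add' w w' := by simp [gradedBabyVerma.tmul, TensorProduct.tmul_add]
  map_smul' c w := by
    simp only [gradedBabyVerma.tmul, TensorProduct.tmul_smul, RingHom.id_apply]
    rfl

theorem verma_apply (w : M) : verma (p := p) χ w = gradedBabyVerma.tmul (p := p) χ 1 w := rfl

theorem tmul_eq_smul_verma (a : RedEnv (glFull F m n p) χ) (w : M) :
    gradedBabyVerma.tmul χ a w = a • verma (p := p) χ w := by
  rw [verma_apply, gradedBabyVerma.tmul, gradedBabyVerma.tmul, ← map_smul,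
    TensorProduct.smul_tmul', smul_eq_mul, mul_one]

theorem verma_induction {P : gradedBabyVerma (p := p) χ M → Prop} (zero : P 0)
    (smul : ∀ (a : RedEnv (glFull F m n p) χ) (w : M), P (a • verma (p := p) χ w)) (add : ∀ y z, P y → P z → P (y + z)) (z) : P z := by
  obtain ⟨t, rfl⟩ := (balance χ M).mkQ_surjective z
  induction t using TensorProduct.induction_on with
  | zero => rw [map_zero]; exact zero
  | tmul a w =>
    have h := smul a w
    rwa [← tmul_eq_smul_verma] at h
  | add x y hx hy => rw [map_add]; exact add _ _ hx hy

theorem incl_ι (x : (glPlus F m n p).carrier) :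
    RedEnv.incl (T := glFull F m n p) χ le_top (RedEnv.ι (glPlus F m n p) χ x)
      = RedEnv.ι (glFull F m n p) χ ⟨x.1, trivial⟩ :=
  RedEnv.lift_ι _ _ _ _ _ x

theorem proj_ι (x : (glPlus F m n p).carrier) :
    proj χ (RedEnv.ι (glPlus F m n p) χ x)
      = RedEnv.ι (glEven F m n p) χ (plusToEven m n p x) :=
  RedEnv.lift_ι _ _ _ _ _ x

theorem incl_smul_verma (b : RedEnv (glPlus F m n p) χ) (w : M) :
    RedEnv.incl (T := glFull F m n p) χ le_top b • verma (p := p) χ w = verma (p := p) χ (proj χ b • w) := by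
  rw [← tmul_eq_smul_verma, verma_apply]
  refine (Submodule.Quotient.eq _).2 (Submodule.subset_span ⟨1, b, w, ?_⟩)
  rw [one_mul]

theorem ι_smul_verma (x : (glPlus F m n p).carrier) (w : M) :
    RedEnv.ι (glFull F m n p) χ ⟨x.1, trivial⟩ • verma (p := p) χ w
      = verma (p := p) χ (RedEnv.ι (glEven F m n p) χ (plusToEven m n p x) • w) := by
  have h := incl_smul_verma χ (RedEnv.ι (glPlus F m n p) χ x) w
  rwa [incl_ι, proj_ι] at h

theorem diagMat_mem_upperBlock (x : DiagBlocks F m n) : diagMat F m n x ∈ upperBlock F m n :=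
  fun _ _ => rfl

theorem upMat_mem_upperBlock (b : Matrix (Fin m) (Fin n) F) :
    upMat F m n b ∈ upperBlock F m n :=
  fun _ _ => rfl

theorem envDiag_smul_verma (x : DiagBlocks F m n) (w : M) :
    envDiag (p := p) χ x • verma (p := p) χ w = verma (p := p) χ (evenDiag (p := p) χ x • w) := by
  have h := ι_smul_verma χ (⟨diagMat F m n x, diagMat_mem_upperBlock x⟩ :
    (glPlus F m n p).carrier) w
  have e : plusToEven m n p ⟨diagMat F m n x, diagMat_mem_upperBlock x⟩
      = ⟨diagMat F m n x, diagMat_mem x⟩ := Subtype.ext (evenComp_of_even (diagMat_mem x))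
  rw [e] at h
  exact h

theorem envUp_smul_verma (b : Matrix (Fin m) (Fin n) F) (w : M) :
    envUp (p := p) χ b • verma (p := p) χ w = 0 := by
  have h := ι_smul_verma χ (⟨upMat F m n b, upMat_mem_upperBlock b⟩ :
    (glPlus F m n p).carrier) w
  have e : plusToEven m n p ⟨upMat F m n b, upMat_mem_upperBlock b⟩ = 0 :=
    Subtype.ext (evenComp_of_odd (upMat_mem b))
  rw [e, map_zero, zero_smul, map_zero] at h
  exact h

/-- A subspace of a `u(𝔤, χ)`-module stable under `𝔤₀`, `𝔤₁` and `𝔤₋₁` is stable under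
`u(𝔤, χ)`. -/
theorem smul_mem_of_blocks {Z : Type*} [AddCommGroup Z] [Module F Z]
    [Module (RedEnv (glFull F m n p) χ) Z] [IsScalarTower F (RedEnv (glFull F m n p) χ) Z]
    (W : Submodule F Z)
    (hd : ∀ x, ∀ w ∈ W, envDiag (p := p) χ x • w ∈ W)
    (hu : ∀ x, ∀ w ∈ W, envUp (p := p) χ x • w ∈ W)
    (hl : ∀ x, ∀ w ∈ W, envDown (p := p) χ x • w ∈ W) (a : RedEnv (glFull F m n p) χ) :
    ∀ w ∈ W, a • w ∈ W :=
  RedEnv.smul_mem_of_ι χ _ W (fun x w hw => by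
    rw [envι_eq, add_smul, add_smul]
    exact add_mem (add_mem (hd _ _ hw) (hu _ _ hw)) (hl _ _ hw)) a

theorem even_smul_mem_of_diag [IsScalarTower F (RedEnv (glEven F m n p) χ) M]
    (W : Submodule F M) (hd : ∀ x, ∀ w ∈ W, evenDiag (p := p) χ x • w ∈ W)
    (a : RedEnv (glEven F m n p) χ) : ∀ w ∈ W, a • w ∈ W :=
  RedEnv.smul_mem_of_ι χ _ W (fun x w hw => by
    have h := hd (diagOf x.1) w hw
    rw [evenDiag_apply] at h
    have e : (⟨diagMat F m n (diagOf x.1), diagMat_mem _⟩ : (glEven F m n p).carrier) = x :=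
      Subtype.ext (eq_diagMat_of_even x.2).symm
    rwa [e] at h) a

/-- A linear map from `Z^χ(M)` determined by a `u(𝔤, χ)`-action on the target and a compatible map
on `M`. -/
theorem exists_verma_lift {K : Type*} [AddCommGroup K] [Module F K]
    (ρ : RedEnv (glFull F m n p) χ →ₐ[F] Module.End F K) (φ : M →ₗ[F] K)
    (h : ∀ b w, ρ (RedEnv.incl χ le_top b) (φ w) = φ (proj χ b • w)) :
    ∃ Ψ : gradedBabyVerma (p := p) χ M →ₗ[F] K, (∀ a z, Ψ (a • z) = ρ a (Ψ z)) ∧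
      ∀ w, Ψ (verma (p := p) χ w) = φ w := by
  let Ψ' : RedEnv (glFull F m n p) χ ⊗[F] M →ₗ[F] K :=
    TensorProduct.lift ((LinearMap.lcomp F K φ).comp ρ.toLinearMap)
  have hΨ : ∀ a w, Ψ' (a ⊗ₜ w) = ρ a (φ w) := fun a w => TensorProduct.lift.tmul a w
  have hs : ∀ a t, Ψ' (a • t) = ρ a (Ψ' t) := by
    intro a t
    induction t using TensorProduct.induction_on with
    | zero => simp
    | tmul b w =>
      rw [TensorProduct.smul_tmul', hΨ, hΨ, smul_eq_mul, map_mul, Module.End.mul_apply]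
    | add x y hx hy => rw [smul_add, map_add, hx, hy, map_add, map_add]
  -- With `K` a `u(𝔤, χ)`-module through `ρ`, the kernel is a submodule, so it contains `balance` as
  -- soon as it contains the generators.
  let _ : Module (RedEnv (glFull F m n p) χ) K := Module.compHom K ρ.toRingHom
  let Ψ'' : RedEnv (glFull F m n p) χ ⊗[F] M →ₗ[RedEnv (glFull F m n p) χ] K :=
    { toFun := Ψ', map_add' := map_add Ψ', map_smul' := hs }
  have hb : balance χ M ≤ LinearMap.ker Ψ'' := by
    refine Submodule.span_le.2 ?_
    rintro _ ⟨a, b, w, rfl⟩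
    change Ψ' _ = 0
    rw [map_sub, hΨ, hΨ, map_mul, Module.End.mul_apply, h, sub_self]
  let Φ := (balance χ M).liftQ Ψ'' hb
  refine ⟨{ toFun := Φ, map_add' := map_add Φ, map_smul' := fun c z => ?_ },
    fun a z => map_smul Φ a z, fun w => ?_⟩
  · have e : c • z = algebraMap F (RedEnv (glFull F m n p) χ) c • z := by
      rw [algebraMap_smul]
    rw [e, map_smul]
    change ρ (algebraMap F _ c) _ = _
    rw [AlgHom.commutes]
    rfl
  · change Ψ' ((1 : RedEnv (glFull F m n p) χ) ⊗ₜ w) = _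
    rw [hΨ, map_one]
    rfl

theorem diagMat_mul_diagMat (x y : DiagBlocks F m n) :
    diagMat F m n x * diagMat F m n y = diagMat F m n (x * y) := by
  simp [diagMat_apply, Matrix.fromBlocks_multiply]

theorem diagMat_mul_odd (x : DiagBlocks F m n) (b c) :
    diagMat F m n x * (upMat F m n b + downMat F m n c)
      = upMat F m n (x.1 * b) + downMat F m n (x.2 * c) := by
  simp [diagMat_apply, upMat_apply, downMat_apply, Matrix.fromBlocks_multiply,
    Matrix.fromBlocks_add]

theorem odd_mul_diagMat (x : DiagBlocks F m n) (b c) :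
    (upMat F m n b + downMat F m n c) * diagMat F m n x
      = upMat F m n (b * x.2) + downMat F m n (c * x.1) := by
  simp [diagMat_apply, upMat_apply, downMat_apply, Matrix.fromBlocks_multiply,
    Matrix.fromBlocks_add]

theorem odd_mul_odd (b c b' c') :
    (upMat F m n b + downMat F m n c) * (upMat F m n b' + downMat F m n c')
      = diagMat F m n (b * c', c * b') := by
  simp [diagMat_apply, upMat_apply, downMat_apply, Matrix.fromBlocks_multiply,
    Matrix.fromBlocks_add]

/-- A homomorphism out of `u(𝔤, χ)` from operators satisfying the relations of `gl(m|n)`. -/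
theorem exists_lift_of_blockRelations {A : Type*} [Ring A] [Algebra F A]
    {X : DiagBlocks F m n →ₗ[F] A} {E : Matrix (Fin m) (Fin n) F →ₗ[F] A}
    {Y : Matrix (Fin n) (Fin m) F →ₗ[F] A} (h : BlockRelations X E Y)
    (hp : ∀ x, X x ^ p - X (x ^ p)
      = algebraMap F A (χ ⟨diagMat F m n x, diagMat_mem x⟩ ^ p)) :
    ∃ ρ : RedEnv (glFull F m n p) χ →ₐ[F] A,
      (∀ x, ρ (envDiag χ x) = X x) ∧ (∀ b, ρ (envUp χ b) = E b) ∧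
      ∀ c, ρ (envDown χ c) = Y c := by
  let g : Mat F m n →ₗ[F] A := X ∘ₗ diagOf + E ∘ₗ upOf + Y ∘ₗ downOf
  have g1 : ∀ x, g (diagMat F m n x) = X x := fun x => by
    change X x + E 0 + Y 0 = X x
    simp
  have g2 : ∀ x, g (upMat F m n x) = E x := fun x => by
    change X 0 + E x + Y 0 = E x
    simp
  have g3 : ∀ x, g (downMat F m n x) = Y x := fun x => by
    change X 0 + E 0 + Y x = Y x
    simp
  let f : (glFull F m n p).carrier →ₗ[F] A := g ∘ₗ (glFull F m n p).carrier.subtype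
  have hf : ∀ x, f x = g x.1 := fun _ => rfl
  refine ⟨RedEnv.lift f ?_ ?_, fun x => ?_, fun x => ?_, fun x => ?_⟩
  · intro i j x y hx hy
    change g x.1 * g y.1 - sgn F i j • (g y.1 * g x.1)
      = g (x.1 * y.1 - sgn F i j • (y.1 * x.1))
    rcases zmod_two_cases i with rfl | rfl <;> rcases zmod_two_cases j with rfl | rfl
    · rw [eq_diagMat_of_even hx, eq_diagMat_of_even hy]
      simp only [g1, sgn_zero_left, one_smul, diagMat_mul_diagMat, ← map_sub]
      rw [h.diag_diag]
    · rw [eq_diagMat_of_even hx, eq_of_odd hy]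
      simp only [sgn_zero_left, one_smul, diagMat_mul_odd, odd_mul_diagMat]
      simp only [map_add, map_sub, g1, g2, g3, mul_add, add_mul]
      have h1 := h.diag_up (diagOf x.1) (upOf y.1)
      have h2 := h.diag_down (diagOf x.1) (downOf y.1)
      rw [map_sub] at h1 h2
      rw [add_sub_add_comm, add_sub_add_comm, h1, h2]
    · rw [eq_diagMat_of_even hy, eq_of_odd hx]
      simp only [sgn_zero_right, one_smul, diagMat_mul_odd, odd_mul_diagMat]
      simp only [map_add, map_sub, g1, g2, g3, mul_add, add_mul]
      have h1 := h.diag_up (diagOf y.1) (upOf x.1)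
      have h2 := h.diag_down (diagOf y.1) (downOf x.1)
      rw [map_sub] at h1 h2
      rw [add_sub_add_comm, add_sub_add_comm, ← neg_sub, h1, ← neg_sub (_ * Y _), h2, neg_sub,
        neg_sub]
    · rw [eq_of_odd hx, eq_of_odd hy]
      simp only [sgn_one_one, neg_smul, one_smul, sub_neg_eq_add, odd_mul_odd]
      simp only [map_add, g1, g2, g3, mul_add, add_mul]
      have h1 := h.up_down (upOf x.1) (downOf y.1)
      have h2 := h.up_down (upOf y.1) (downOf x.1)
      have h3 := h.up_up (upOf x.1) (upOf y.1)
      have h4 := h.down_down (downOf x.1) (downOf y.1)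
      -- The product of two odd matrices mixes the blocks of the two anticommutators; exchanging the
      -- lower diagonal blocks makes each summand an instance of `up_down`.
      have e : X (upOf x.1 * downOf y.1, downOf x.1 * upOf y.1)
          + X (upOf y.1 * downOf x.1, downOf y.1 * upOf x.1)
          = X (upOf x.1 * downOf y.1, downOf y.1 * upOf x.1)
          + X (upOf y.1 * downOf x.1, downOf x.1 * upOf y.1) := by
        rw [← map_add, ← map_add]
        congr 1
        exact Prod.ext rfl (add_comm _ _)
      rw [e, ← h1, ← h2]
      calc _ = (E (upOf x.1) * E (upOf y.1) + E (upOf y.1) * E (upOf x.1))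
            + (Y (downOf x.1) * Y (downOf y.1) + Y (downOf y.1) * Y (downOf x.1))
            + (E (upOf x.1) * Y (downOf y.1) + Y (downOf y.1) * E (upOf x.1)
            + (E (upOf y.1) * Y (downOf x.1) + Y (downOf x.1) * E (upOf y.1))) := by abel
        _ = _ := by rw [h3, h4, zero_add, zero_add]
  · intro x hx
    have h1 := hp (diagOf x.1)
    have e : (⟨diagMat F m n (diagOf x.1), diagMat_mem _⟩ : part F m n 0) = ⟨x.1, hx⟩ :=
      Subtype.ext (eq_diagMat_of_even hx).symm
    rw [e] at h1
    rw [← h1]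
    change g x.1 ^ p - g (x.1 ^ p) = _
    conv_lhs => rw [eq_diagMat_of_even hx, diagMat_pow, g1, g1]
  · rw [envDiag_apply, RedEnv.lift_ι, hf, g1]
  · rw [envUp_apply, RedEnv.lift_ι, hf, g2]
  · rw [envDown_apply, RedEnv.lift_ι, hf, g3]

variable [IsScalarTower F (RedEnv (glEven F m n p) χ) M]

/-- `Z^χ(M)` maps to `Λ(𝔤₋₁) ⊗ M`. -/
theorem exists_verma_to_extTensor [Fact p.Prime] [CharP F p] :
    ∃ Ψ : gradedBabyVerma (p := p) χ M →ₗ[F] ExtTensor F (Matrix (Fin n) (Fin m) F) M,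
      (∀ w, Ψ (verma (p := p) χ w) = extTmul F _ M 1 w) ∧
      ∀ c z, Ψ (envDown (p := p) χ c • z) = extMul M c (Ψ z) := by
  let σ₀ : RedEnv (glEven F m n p) χ →ₐ[F] Module.End F M := Algebra.lsmul F F M
  let σ : DiagBlocks F m n →ₗ[F] Module.End F M := σ₀.toLinearMap ∘ₗ evenDiag χ
  have hσ : ∀ x, σ x = σ₀ (evenDiag χ x) := fun _ => rfl
  obtain ⟨X, E, hR, hpth, hX, hE⟩ := exists_blockRelations p σ
    (fun x => χ ⟨diagMat F m n x, diagMat_mem x⟩ ^ p)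
    (fun x y => by rw [hσ, hσ, hσ, ← evenDiag_bracket, map_sub, map_mul, map_mul])
    (fun x => by rw [hσ, hσ, ← map_pow, ← map_sub, evenDiag_pth, AlgHom.commutes])
  obtain ⟨ρ, h1, h2, h3⟩ := exists_lift_of_blockRelations χ hR hpth
  -- Compatibility with `u(𝔤⁺, χ)` is checked on generators: the diagonal blocks act on `1 ⊗ M`
  -- through `σ` and the upper right block acts by zero, as prescribed by `proj`.
  obtain ⟨Ψ, h4, h5⟩ := exists_verma_lift (M := M) χ ρ (extTmul F _ M 1) (fun b => by
    induction b using RedEnv.induction with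
    | algebraMap c =>
      intro w
      rw [AlgHom.commutes, AlgHom.commutes, AlgHom.commutes, algebraMap_smul, map_smul]
      rfl
    | ι x =>
      intro w
      have e : RedEnv.incl (T := glFull F m n p) χ le_top (RedEnv.ι (glPlus F m n p) χ x)
          = envDiag χ (diagOf x.1) + envUp χ (upOf x.1) := by
        have e0 : downOf x.1 = 0 := by ext a b; exact x.2 a b
        rw [incl_ι, envι_eq, e0, map_zero, add_zero]
      rw [e, map_add, h1, h2, LinearMap.add_apply, hX, hE, add_zero, proj_ι]
      have e2 : plusToEven m n p x = ⟨diagMat F m n (diagOf x.1), diagMat_mem _⟩ := by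
        refine Subtype.ext ?_
        change evenComp F m n x.1 = _
        rw [eq_diagMat_of_even (evenComp_mem x.1)]
        rfl
      rw [e2]
      rfl
    | mul a b ha hb =>
      intro w
      rw [map_mul, map_mul, Module.End.mul_apply, hb, ha, map_mul, mul_smul]
    | add a b ha hb =>
      intro w
      rw [map_add, map_add, LinearMap.add_apply, ha, hb, map_add, add_smul, map_add])
  exact ⟨Ψ, h5, fun c z => by rw [h4, h3]⟩

/-- The projection of `Z^χ(M)` onto `M` along the image of `𝔤₋₁`. -/
theorem exists_verma_proj [Fact p.Prime] [CharP F p] :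
    ∃ π : gradedBabyVerma (p := p) χ M →ₗ[F] M,
      (∀ w, π (verma (p := p) χ w) = w) ∧ ∀ c z, π (envDown (p := p) χ c • z) = 0 := by
  obtain ⟨Ψ, h1, h2⟩ := exists_verma_to_extTensor (M := M) χ
  -- The augmentation `Λ(𝔤₋₁) → F`, tensored with `M`.
  let q : ExtTensor F (Matrix (Fin n) (Fin m) F) M →ₗ[F] M :=
    extLift ((LinearMap.lsmul F M).comp ExteriorAlgebra.algebraMapInv.toLinearMap)
  have hq : ∀ x w, q (extTmul F _ M x w) = ExteriorAlgebra.algebraMapInv x • w := fun x w =>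
    extLift_extTmul _ x w
  refine ⟨q ∘ₗ Ψ, fun w => ?_, fun c z => ?_⟩
  · rw [LinearMap.comp_apply, h1, hq, map_one, one_smul]
  · rw [LinearMap.comp_apply, h2, ← LinearMap.comp_apply]
    have e : q ∘ₗ extMul M c = 0 := by
      refine extTensor_hom_ext fun x w => ?_
      rw [LinearMap.comp_apply, extMul_extTmul, hq, map_mul]
      simp [ExteriorAlgebra.algebraMapInv]
    rw [e, LinearMap.zero_apply]

theorem verma_injective [Fact p.Prime] [CharP F p] :
    Function.Injective (verma (p := p) χ : M →ₗ[F] _) := by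
  obtain ⟨π, h, -⟩ := exists_verma_proj (M := M) χ
  exact Function.LeftInverse.injective h

theorem oddPos_eq (ij : Fin m × Fin n) :
    oddPos (p := p) χ ij = envUp χ (Matrix.single ij.1 ij.2 1) := by
  rw [envUp_apply, oddPos]
  congr 2
  ext (a | a) (b | b) <;> simp [upMat_apply, Matrix.single_apply]

theorem oddNeg_eq (ij : Fin m × Fin n) :
    oddNeg (p := p) χ ij = envDown χ (Matrix.single ij.2 ij.1 1) := by
  rw [envDown_apply, oddNeg]
  congr 2
  ext (a | a) (b | b) <;> simp [downMat_apply, Matrix.single_apply]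

/-- The product of all odd negative root vectors does not kill `1 ⊗ M`. -/
theorem oddNeg_prod_smul_verma_injective [Fact p.Prime] [CharP F p]
    (t : Fin (m * n) ≃ Fin m × Fin n) {w : M}
    (hw : (List.ofFn fun k => oddNeg (p := p) χ (t k)).prod • verma (p := p) χ w = 0) : w = 0 := by
  obtain ⟨Ψ, h1, h2⟩ := exists_verma_to_extTensor (M := M) χ
  -- The matrix units of `𝔤₋₁` in the order given by `t`; the indices are exchanged because the pair
  -- `(i, j)` labels `e_{ji}`.
  let e : Module.Basis (Fin (m * n)) F (Matrix (Fin n) (Fin m) F) :=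
    (Matrix.stdBasis F (Fin n) (Fin m)).reindex (t.trans (Equiv.prodComm _ _)).symm
  have he : ∀ k, e k = Matrix.single (t k).2 (t k).1 1 := fun k => by
    simp only [e, Module.Basis.reindex_apply]
    exact Matrix.stdBasis_eq_single F (t k).2 (t k).1
  have hL : ∀ L : List (Fin (m * n)),
      Ψ ((L.map fun k => oddNeg (p := p) χ (t k)).prod • verma (p := p) χ w)
        = extTmul F _ M (L.map fun k => ExteriorAlgebra.ι F (e k)).prod w := by
    intro L
    induction L with
    | nil => simp [h1]
    | cons k L ih =>
      rw [List.map_cons, List.prod_cons, mul_smul, oddNeg_eq, h2, ih, extMul_extTmul,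
        List.map_cons, List.prod_cons, he]
  have h3 := hL (List.finRange (m * n))
  rw [← List.ofFn_eq_map, ← List.ofFn_eq_map, hw, map_zero,
    ← ExteriorAlgebra.ιMulti_apply] at h3
  -- The functional reading off the top degree by the determinant in the basis `e`; it takes the
  -- value `1` on the product of that basis.
  let θ : ExteriorAlgebra F (Matrix (Fin n) (Fin m) F) →ₗ[F] F :=
    ExteriorAlgebra.liftAlternating (Pi.single (m * n) e.det)
  let q : ExtTensor F (Matrix (Fin n) (Fin m) F) M →ₗ[F] M :=
    extLift ((LinearMap.lsmul F M).comp θ)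
  have h4 := congrArg q h3
  rw [map_zero, extLift_extTmul] at h4
  have h5 : θ (ExteriorAlgebra.ιMulti F (m * n) fun k => e k) = 1 := by
    simp only [θ]
    rw [ExteriorAlgebra.liftAlternating_apply_ιMulti, Pi.single_eq_same]
    exact e.det_self
  change (0 : M) = θ _ • w at h4
  rw [h5, one_smul] at h4
  exact h4.symm

end BabyVerma

/-! ### Heights of words and the scalar attached to a weight. -/

section Height

variable {F : Type*} [Field F] {m n p : ℕ} (χ : Module.Dual F (part F m n 0))

/-- The matrix units in `u(𝔤, χ)`. -/
def envUnit (ab : (Fin m ⊕ Fin n) × (Fin m ⊕ Fin n)) : RedEnv (glFull F m n p) χ :=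
  RedEnv.ι (glFull F m n p) χ ⟨Matrix.single ab.1 ab.2 1, trivial⟩

/-- The height of a root: the difference of the column and row numbers of a matrix unit. -/
def unitHeight (ab : (Fin m ⊕ Fin n) × (Fin m ⊕ Fin n)) : ℤ :=
  (finSumFinEquiv ab.2 : ℕ) - (finSumFinEquiv ab.1 : ℕ)

theorem single_mem_part (a b : Fin m ⊕ Fin n) :
    Matrix.single a b (1 : F) ∈ part F m n (par a + par b) := by
  intro i j h
  rw [Matrix.single_apply]
  split_ifs with h'
  · obtain ⟨rfl, rfl⟩ := h'
    exact absurd (by rw [add_assoc, CharTwo.add_self_eq_zero, add_zero]) h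
  · rfl

theorem single_mem_cartan (a : Fin m ⊕ Fin n) : Matrix.single a a (1 : F) ∈ cartan F m n := by
  intro i j h
  rw [Matrix.single_apply, if_neg]
  rintro ⟨rfl, rfl⟩
  exact h rfl

/-- The supercommutator as a rewriting rule. Straightening words uses only its shape, so the sign
stays unspecified. -/
theorem envUnit_mul_envUnit (a b c d : Fin m ⊕ Fin n) :
    ∃ ε : F, envUnit (p := p) χ (a, b) * envUnit χ (c, d)
      = ε • (envUnit χ (c, d) * envUnit χ (a, b))
        + (if b = c then envUnit χ (a, d) else 0) - ε • (if d = a then envUnit χ (c, b) else 0) := by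
  refine ⟨sgn F (par a + par b) (par c + par d), ?_⟩
  have h := RedEnv.ι_bracket (glFull F m n p) χ _ _ ⟨Matrix.single a b 1, trivial⟩
    ⟨Matrix.single c d 1, trivial⟩ (single_mem_part a b) (single_mem_part c d)
  rw [sub_eq_iff_eq_add] at h
  have e2 : RedEnv.ι (glFull F m n p) χ ⟨Matrix.single a b 1 * Matrix.single c d 1
        - sgn F (par a + par b) (par c + par d) • (Matrix.single c d 1 * Matrix.single a b 1),
        trivial⟩
      = (if b = c then envUnit χ (a, d) else 0)
        - sgn F (par a + par b) (par c + par d) • (if d = a then envUnit χ (c, b) else 0) := by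
    have e3 : ∀ a b c d : Fin m ⊕ Fin n, RedEnv.ι (glFull F m n p) χ
        ⟨Matrix.single a b 1 * Matrix.single c d 1, trivial⟩
        = if b = c then envUnit χ (a, d) else 0 := by
      intro a b c d
      split_ifs with h
      · subst h
        unfold envUnit
        congr 2
        simp
      · rw [← map_zero (RedEnv.ι (glFull F m n p) χ)]
        congr 1
        exact Subtype.ext (Matrix.single_mul_single_of_ne _ _ _ _ h _)
    rw [← e3, ← e3, ← map_smul, ← map_sub]
    rfl
  refine Eq.trans h ?_
  refine (congrArg (· + _) e2).trans ?_
  unfold envUnit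
  abel

/-- The left ideal of `u(𝔤, χ)` that annihilates the highest weight vectors of weight `wt`. -/
def weightIdeal (wt : Module.Dual F (cartan F m n)) :
    Submodule (RedEnv (glFull F m n p) χ) (RedEnv (glFull F m n p) χ) :=
  Submodule.span _ ({x | ∃ ab, 0 < unitHeight ab ∧ x = envUnit χ ab} ∪
    {x | ∃ a, x = envUnit χ (a, a) - algebraMap F _ (wt ⟨_, single_mem_cartan a⟩)})

/-- The span of the products of strictly lower triangular matrix units of total height `h`. -/
def lowerWords (h : ℤ) : Submodule F (RedEnv (glFull F m n p) χ) :=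
  Submodule.span F {x | ∃ L : List ((Fin m ⊕ Fin n) × (Fin m ⊕ Fin n)),
    (∀ ab ∈ L, unitHeight ab < 0) ∧ (L.map unitHeight).sum = h ∧ x = (L.map (envUnit χ)).prod}

/-- The sum of the left ideal `weightIdeal` and of the lower triangular words of height `h`. -/
def weightSpace (wt : Module.Dual F (cartan F m n)) (h : ℤ) :
    Submodule F (RedEnv (glFull F m n p) χ) :=
  (weightIdeal χ wt).restrictScalars F ⊔ lowerWords χ h

variable {χ}

/-- The left ideal is stable under left multiplication by anything, so only the lower triangular
words need checking. -/
theorem mul_mem_weightSpace_of_words {wt : Module.Dual F (cartan F m n)} {h h' : ℤ}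
    {a x : RedEnv (glFull F m n p) χ}
    (ha : ∀ L : List ((Fin m ⊕ Fin n) × (Fin m ⊕ Fin n)), (∀ ab ∈ L, unitHeight ab < 0) →
      (L.map unitHeight).sum = h → a * (L.map (envUnit χ)).prod ∈ weightSpace χ wt h')
    (hx : x ∈ weightSpace χ wt h) : a * x ∈ weightSpace χ wt h' := by
  obtain ⟨y, hy, z, hz, rfl⟩ := Submodule.mem_sup.1 hx
  clear hx
  rw [mul_add]
  refine add_mem (Submodule.mem_sup_left ((weightIdeal χ wt).smul_mem a hy)) ?_
  induction hz using Submodule.span_induction with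
  | mem z hz =>
    obtain ⟨L, h1, h2, rfl⟩ := hz
    exact ha L h1 h2
  | zero => rw [mul_zero]; exact zero_mem _
  | add z z' _ _ hz hz' => rw [mul_add]; exact add_mem hz hz'
  | smul c z _ hz => rw [mul_smul_comm]; exact Submodule.smul_mem _ _ hz

theorem envUnit_mul_mem_of_neg {wt : Module.Dual F (cartan F m n)} {h : ℤ}
    {ab : (Fin m ⊕ Fin n) × (Fin m ⊕ Fin n)} (hab : unitHeight ab < 0)
    {x : RedEnv (glFull F m n p) χ} (hx : x ∈ weightSpace χ wt h) :
    envUnit χ ab * x ∈ weightSpace χ wt (unitHeight ab + h) :=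
  mul_mem_weightSpace_of_words (fun L h1 h2 => Submodule.mem_sup_right
    (Submodule.subset_span ⟨ab :: L, by
      simpa [hab] using h1, by simp [h2], by simp⟩)) hx

theorem unitHeight_mul (a b d : Fin m ⊕ Fin n) :
    unitHeight (a, d) = unitHeight (a, b) + unitHeight (b, d) := by
  simp [unitHeight]

/-- Straightening. The new unit is moved to the right through the word; each bracket is again a
unit, of the summed height, in front of a shorter word, so the induction runs over all units at
once. At the empty word a unit of negative height is a lower word, a diagonal one is a scalar modulo
the ideal, and one of positive height lies in the ideal. -/
theorem envUnit_mul_word_mem (wt : Module.Dual F (cartan F m n))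
    (L : List ((Fin m ⊕ Fin n) × (Fin m ⊕ Fin n))) (hL : ∀ ab ∈ L, unitHeight ab < 0)
    (ab : (Fin m ⊕ Fin n) × (Fin m ⊕ Fin n)) :
    envUnit (p := p) χ ab * (L.map (envUnit χ)).prod
      ∈ weightSpace χ wt (unitHeight ab + (L.map unitHeight).sum) := by
  induction L generalizing ab with
  | nil =>
    obtain ⟨a, b⟩ := ab
    simp only [List.map_nil, List.prod_nil, mul_one, List.sum_nil, add_zero]
    rcases lt_trichotomy (unitHeight (a, b)) 0 with h | h | h
    · refine Submodule.mem_sup_right (Submodule.subset_span ⟨[(a, b)], ?_, ?_, ?_⟩) <;> simp [h]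
    · have hab : a = b := by
        simp only [unitHeight] at h
        exact finSumFinEquiv.injective (Fin.ext (by omega))
      subst hab
      rw [h]
      refine Submodule.mem_sup.2 ⟨_, Submodule.subset_span (Or.inr ⟨a, rfl⟩),
        algebraMap F _ (wt ⟨_, single_mem_cartan a⟩), ?_, sub_add_cancel _ _⟩
      rw [Algebra.algebraMap_eq_smul_one]
      exact Submodule.smul_mem _ _ (Submodule.subset_span ⟨[], by simp, by simp, by simp⟩)
    · exact Submodule.mem_sup_left (Submodule.subset_span (Or.inl ⟨_, h, rfl⟩))
  | cons cd L ih =>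
    obtain ⟨a, b⟩ := ab
    obtain ⟨c, d⟩ := cd
    have hcd := hL (c, d) (by simp)
    have hL' : ∀ ab ∈ L, unitHeight ab < 0 := fun x hx => hL x (by simp [hx])
    obtain ⟨ε, hε⟩ := envUnit_mul_envUnit (p := p) χ a b c d
    simp only [List.map_cons, List.prod_cons, List.sum_cons]
    rw [← mul_assoc, hε, sub_mul, add_mul, smul_mul_assoc, smul_mul_assoc, mul_assoc]
    refine sub_mem (add_mem (Submodule.smul_mem _ _ ?_) ?_) (Submodule.smul_mem _ _ ?_)
    · have := envUnit_mul_mem_of_neg hcd (ih hL' (a, b))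
      rwa [add_left_comm] at this
    · split_ifs with h
      · subst h
        rw [← add_assoc, ← unitHeight_mul]
        exact ih hL' _
      · rw [zero_mul]; exact zero_mem _
    · split_ifs with h
      · subst h
        rw [← add_assoc, add_comm (unitHeight _), ← unitHeight_mul]
        exact ih hL' _
      · rw [zero_mul]; exact zero_mem _

theorem word_mem_weightSpace (wt : Module.Dual F (cartan F m n))
    (L : List ((Fin m ⊕ Fin n) × (Fin m ⊕ Fin n))) :
    (L.map (envUnit (p := p) χ)).prod ∈ weightSpace χ wt (L.map unitHeight).sum := by
  induction L with
  | nil => exact Submodule.mem_sup_right (Submodule.subset_span ⟨[], by simp, by simp, by simp⟩)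
  | cons ab L ih =>
    simp only [List.map_cons, List.prod_cons, List.sum_cons]
    exact mul_mem_weightSpace_of_words
      (fun K h1 h2 => by rw [← h2]; exact envUnit_mul_word_mem wt K h1 ab) ih

/-- A nonempty lower triangular word has negative height, so only the empty word contributes. -/
theorem lowerWords_zero_le : lowerWords (p := p) χ 0 ≤ Submodule.span F {1} := by
  refine Submodule.span_le.2 ?_
  rintro _ ⟨L, h1, h2, rfl⟩
  rcases L with _ | ⟨ab, L⟩
  · exact Submodule.subset_span (by simp)
  · exfalso
    have h3 := h1 ab (by simp)
    have h4 : ∀ K : List ((Fin m ⊕ Fin n) × (Fin m ⊕ Fin n)), (∀ x ∈ K, unitHeight x < 0) →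
        (K.map unitHeight).sum ≤ 0 := by
      intro K hK
      induction K with
      | nil => simp
      | cons x K ih =>
        have h5 := hK x (by simp)
        have h6 := ih fun y hy => hK y (by simp [hy])
        simp only [List.map_cons, List.sum_cons]
        omega
    have h7 := h4 L fun x hx => h1 x (by simp [hx])
    simp only [List.map_cons, List.sum_cons] at h2
    omega

/-- A word of height zero is a scalar modulo the left ideal `weightIdeal`. -/
theorem exists_scalar_of_word (wt : Module.Dual F (cartan F m n))
    (L : List ((Fin m ⊕ Fin n) × (Fin m ⊕ Fin n))) (hL : (L.map unitHeight).sum = 0) :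
    ∃ c : F, (L.map (envUnit (p := p) χ)).prod - algebraMap F _ c ∈ weightIdeal χ wt := by
  have h := word_mem_weightSpace (p := p) (χ := χ) wt L
  rw [hL] at h
  obtain ⟨y, hy, z, hz, e⟩ := Submodule.mem_sup.1 h
  obtain ⟨c, rfl⟩ := Submodule.mem_span_singleton.1 (lowerWords_zero_le hz)
  refine ⟨c, ?_⟩
  rw [← e, Algebra.algebraMap_eq_smul_one, add_sub_cancel_right]
  exact hy

-- The heights of `e_{ij}` and `e_{ji}` are opposite, so the total height of the word is zero
-- whatever the enumerations.
variable (χ) in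
theorem exists_scalar_oddProd (s t : Fin (m * n) ≃ Fin m × Fin n)
    (wt : Module.Dual F (cartan F m n)) :
    ∃ c : F, oddProd (p := p) χ s t - algebraMap F _ c ∈ weightIdeal χ wt := by
  have h := exists_scalar_of_word (p := p) (χ := χ) wt
    ((List.ofFn fun k => (Sum.inl (s k).1, Sum.inr (s k).2))
      ++ List.ofFn fun k => (Sum.inr (t k).2, Sum.inl (t k).1)) (by
    rw [List.map_append, List.sum_append, List.map_ofFn, List.map_ofFn, List.sum_ofFn,
      List.sum_ofFn]
    have h1 : ∑ k, (unitHeight ∘ fun k => (Sum.inl (s k).1, Sum.inr (s k).2)) k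
        = ∑ ij : Fin m × Fin n, unitHeight (Sum.inl ij.1, Sum.inr ij.2) :=
      s.sum_comp fun ij => unitHeight (Sum.inl ij.1, Sum.inr ij.2)
    have h2 : ∑ k, (unitHeight ∘ fun k => (Sum.inr (t k).2, Sum.inl (t k).1)) k
        = ∑ ij : Fin m × Fin n, unitHeight (Sum.inr ij.2, Sum.inl ij.1) :=
      t.sum_comp fun ij => unitHeight (Sum.inr ij.2, Sum.inl ij.1)
    rw [h1, h2, ← Finset.sum_add_distrib]
    exact Finset.sum_eq_zero fun ij _ => by simp [unitHeight])
  rw [List.map_append, List.prod_append, List.map_ofFn, List.map_ofFn] at h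
  exact h

/-- The left ideal `weightIdeal` kills `1 ⊗ v` for a maximal vector `v`. -/
theorem weightIdeal_smul_verma {M : Type*} [AddCommGroup M] [Module F M]
    [Module (RedEnv (glEven F m n p) χ) M] [IsScalarTower F (RedEnv (glEven F m n p) χ) M]
    {gr : ZMod 2 → Submodule F M} {wt : Module.Dual F (cartan F m n)} {v : M}
    (hv : IsMaximalVector (p := p) χ gr wt v) {x : RedEnv (glFull F m n p) χ}
    (hx : x ∈ weightIdeal χ wt) : x • verma (p := p) χ v = 0 := by
  induction hx using Submodule.span_induction with
  | mem x hx =>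
    have key : ∀ (A : Mat F m n) (hA : A ∈ part F m n 0),
        RedEnv.ι (glFull F m n p) χ ⟨A, trivial⟩ • verma (p := p) χ v
          = verma (p := p) χ (RedEnv.ι (glEven F m n p) χ ⟨A, hA⟩ • v) := by
      intro A hA
      have h := envDiag_smul_verma (p := p) χ (diagOf A) v
      rw [envDiag_apply, evenDiag_apply] at h
      simpa only [← eq_diagMat_of_even hA] using h
    rcases hx with ⟨⟨a, b⟩, hab, rfl⟩ | ⟨a, rfl⟩
    · by_cases hp : par a = par b
      · have h0 : Matrix.single a b (1 : F) ∈ part F m n 0 := by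
          have := single_mem_part (F := F) a b
          rwa [hp, CharTwo.add_self_eq_zero] at this
        rw [envUnit, key _ h0, hv.nil_smul, map_zero]
        refine Submodule.subset_span ⟨a, b, hp, ?_, rfl⟩
        simp only [unitHeight] at hab
        exact Fin.lt_def.2 (by omega)
      -- An odd unit of positive height lies in the upper right block and kills `1 ⊗ M`; those of
      -- the lower left block have negative height.
      · rcases a with a | a <;> rcases b with b | b
        · exact absurd rfl hp
        · have h := envUp_smul_verma (p := p) χ (Matrix.single a b 1) v
          rw [← oddPos_eq χ (a, b)] at h
          exact h
        · exfalso
          simp only [unitHeight, finSumFinEquiv_apply_left, finSumFinEquiv_apply_right,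
            Fin.val_castAdd, Fin.val_natAdd] at hab
          have := b.2
          omega
        · exact absurd rfl hp
    · rw [sub_smul, envUnit, key _ (cartan_le_even (single_mem_cartan a)),
        hv.weight ⟨_, single_mem_cartan a⟩, algebraMap_smul, map_smul, sub_self]
  | zero => rw [zero_smul]
  | add x y _ _ hx hy => rw [add_smul, hx, hy, add_zero]
  | smul a x _ hx => rw [smul_eq_mul, mul_smul, hx, smul_zero]

end Height

/-! ### Ordered words in an anticommuting family acting on a module. -/

section OddSpan

variable {F U Z ι : Type*} [Field F] [Ring U] [Algebra F U] [AddCommGroup Z] [Module F Z]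
  [Module U Z] [IsScalarTower F U Z]

theorem smul_mem_of_mem_span_range {f : ι → U} {y : U} (hy : y ∈ Submodule.span F (Set.range f))
    {W : Submodule F Z} {w : Z} (h : ∀ a, f a • w ∈ W) : y • w ∈ W := by
  induction hy using Submodule.span_induction with
  | mem y hy => obtain ⟨a, rfl⟩ := hy; exact h a
  | zero => rw [zero_smul]; exact zero_mem _
  | add y z _ _ hy hz => rw [add_smul]; exact add_mem hy hz
  | smul c y _ hy => rw [smul_assoc]; exact W.smul_mem c hy

/-- The span of the elements `f_{a₁} ⋯ f_{aᵣ} y` with `a₁, …, aᵣ` a sublist of a given list and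
`y ∈ G (k + r)`. -/
def sublistSpan (f : ι → U) (G : ZMod 2 → Submodule F Z) : List ι → ZMod 2 → Submodule F Z
  | [], k => G k
  | a :: L, k =>
    sublistSpan f G L k ⊔ (sublistSpan f G L (k + 1)).map (Algebra.lsmul F F Z (f a))

variable {f : ι → U} {G : ZMod 2 → Submodule F Z}

theorem mem_sublistSpan_cons {a : ι} {L : List ι} {k : ZMod 2} {x : Z} :
    x ∈ sublistSpan f G (a :: L) k ↔ ∃ s ∈ sublistSpan f G L k,
      ∃ s' ∈ sublistSpan f G L (k + 1), x = s + f a • s' := by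
  simp only [sublistSpan, Submodule.mem_sup, Submodule.mem_map]
  constructor
  · rintro ⟨s, hs, _, ⟨s', hs', rfl⟩, rfl⟩
    exact ⟨s, hs, s', hs', rfl⟩
  · rintro ⟨s, hs, s', hs', rfl⟩
    exact ⟨s, hs, _, ⟨s', hs', rfl⟩, rfl⟩

/-- A nonzero element can be multiplied into the top degree. -/
theorem exists_smul_eq_prod_smul (hf : ∀ a b, f a * f b = -(f b * f a))
    (hsq : ∀ a, f a * f a = 0) (L : List ι) {k : ZMod 2} {x : Z}
    (hx : x ∈ sublistSpan f G L k) (hx0 : x ≠ 0) :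
    ∃ (g : U) (ε : F), ε * ε = 1 ∧ (∀ a, f a * g = ε • (g * f a)) ∧
      ∃ j, ∃ y ∈ G j, y ≠ 0 ∧ g • x = (L.map f).prod • y := by
  induction L generalizing k x with
  | nil => exact ⟨1, 1, by simp, by simp, k, x, hx, hx0, by simp⟩
  | cons a L ih =>
    obtain ⟨s, hs, s', hs', rfl⟩ := mem_sublistSpan_cons.1 hx
    -- If `s = 0`, the multiplier found for `s'` works once it is moved past `f a`; the sign `ε` is
    -- carried along for this. If `s ≠ 0`, the multiplier `f a * g` works, since `f a * g * f a = 0`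
    -- removes the term with `s'`.
    by_cases h0 : s = 0
    · subst h0
      have h1 : s' ≠ 0 := by rintro rfl; simp at hx0
      obtain ⟨g, ε, h2, h3, j, y, hy, hy0, h4⟩ := ih hs' h1
      refine ⟨ε • g, ε, h2, fun b => ?_, j, y, hy, hy0, ?_⟩
      · rw [mul_smul_comm, h3, smul_mul_assoc]
      · rw [zero_add, ← mul_smul, smul_mul_assoc, ← h3, mul_smul, h4, List.map_cons,
          List.prod_cons, mul_smul]
    · obtain ⟨g, ε, h2, h3, j, y, hy, hy0, h4⟩ := ih hs h0
      refine ⟨f a * g, -ε, by simpa using h2, fun b => ?_, j, y, hy, hy0, ?_⟩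
      · rw [← mul_assoc, hf b a, neg_mul, mul_assoc, h3, mul_smul_comm, neg_smul, mul_assoc]
      · have h5 : f a * g * f a = 0 := by rw [h3, smul_mul_assoc, mul_assoc, hsq, mul_zero, smul_zero]
        rw [smul_add, ← mul_smul, h5, zero_smul, add_zero, mul_smul, h4, List.map_cons,
          List.prod_cons, mul_smul]

/-- The letter `a` is moved to its place in `L`, where it is either inserted or killed by `f a * f a
= 0`. -/
theorem smul_mem_sublistSpan (hf : ∀ a b, f a * f b = -(f b * f a))
    (hsq : ∀ a, f a * f a = 0) {L : List ι} {a : ι} (ha : a ∈ L) {k : ZMod 2} {x : Z}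
    (hx : x ∈ sublistSpan f G L k) : f a • x ∈ sublistSpan f G L (k + 1) := by
  have h2 : ∀ k : ZMod 2, k + 1 + 1 = k := by decide
  induction L generalizing k x with
  | nil => simp at ha
  | cons b L ih =>
    obtain ⟨s, hs, s', hs', rfl⟩ := mem_sublistSpan_cons.1 hx
    rw [smul_add, ← mul_smul]
    rcases List.mem_cons.1 ha with rfl | h
    · rw [hsq, zero_smul, add_zero]
      exact mem_sublistSpan_cons.2 ⟨0, zero_mem _, s, by rwa [h2], by simp⟩
    · rw [hf, neg_smul, mul_smul]
      exact mem_sublistSpan_cons.2 ⟨f a • s, ih h hs, -(f a • s'), neg_mem (ih h hs'), by simp⟩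

theorem le_sublistSpan (L : List ι) (k : ZMod 2) : G k ≤ sublistSpan f G L k := by
  induction L with
  | nil => exact le_rfl
  | cons a L ih => exact ih.trans le_sup_left

/-- The spanning half of PBW for `𝔤₋₁`: any word can be rewritten through ordered words without
repetition. -/
theorem prod_smul_mem_sublistSpan (hf : ∀ a b, f a * f b = -(f b * f a))
    (hsq : ∀ a, f a * f a = 0) {L : List ι} (hL : ∀ a, a ∈ L) (K : List ι) {k : ZMod 2} {y : Z}
    (hy : y ∈ G k) : (K.map f).prod • y ∈ sublistSpan f G L (K.length + k) := by
  induction K with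
  | nil => simpa using le_sublistSpan L k hy
  | cons a K ih =>
    rw [List.map_cons, List.prod_cons, mul_smul]
    have := smul_mem_sublistSpan hf hsq (hL a) ih
    rwa [show ((a :: K).length : ZMod 2) + k = K.length + k + 1 by push_cast [List.length_cons]; ring]

end OddSpan

/-! ### Graded submodules and the grading of `Z^χ(M)`. -/

section Graded

variable {F : Type*} [Field F] {m n p : ℕ} (χ : Module.Dual F (part F m n 0))

/-- The submodule generated by a homogeneous vector is graded. -/
theorem span_singleton_graded (S : RestrictedSub F m n p) {V : Type*} [AddCommGroup V]
    [Module F V] [Module (RedEnv S χ) V] [IsScalarTower F (RedEnv S χ) V]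
    {gr : ZMod 2 → Submodule F V}
    (hgr : ∀ (i j : ZMod 2) (x : S.carrier), x.1 ∈ part F m n i →
      ∀ w ∈ gr j, RedEnv.ι S χ x • w ∈ gr (i + j)) {k : ZMod 2} {v : V} (hv : v ∈ gr k) :
    (Submodule.span (RedEnv S χ) {v}).restrictScalars F
      = ⨆ i, (Submodule.span (RedEnv S χ) {v}).restrictScalars F ⊓ gr i := by
  set N := Submodule.span (RedEnv S χ) {v} with hN
  refine le_antisymm ?_ (iSup_le fun i => inf_le_left)
  have hst := RedEnv.smul_mem_of_ι χ S (⨆ i, N.restrictScalars F ⊓ gr i) (fun x w hw => by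
    induction hw using Submodule.iSup_induction' with
    | mem j w hw =>
      -- An element of `S` need not be homogeneous, so it is split into components. Membership in
      -- `S` is part of the induction because `RedEnv.ι` takes elements of the subtype.
      have h : ∀ y ∈ ⨆ i, S.carrier ⊓ part F m n i, ∃ h : y ∈ S.carrier,
          RedEnv.ι S χ ⟨y, h⟩ • w ∈ ⨆ i, N.restrictScalars F ⊓ gr i := by
        intro y hx
        induction hx using Submodule.iSup_induction' with
        | mem i y hy =>
          exact ⟨hy.1, Submodule.mem_iSup_of_mem (i + j)
            ⟨N.smul_mem _ hw.1, hgr i j ⟨y, hy.1⟩ hy.2 w hw.2⟩⟩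
        | zero =>
          refine ⟨zero_mem _, ?_⟩
          have : (⟨0, zero_mem _⟩ : S.carrier) = 0 := rfl
          rw [this, map_zero, zero_smul]
          exact zero_mem _
        | add y z _ _ hy hz =>
          obtain ⟨h1, h1'⟩ := hy
          obtain ⟨h2, h2'⟩ := hz
          refine ⟨add_mem h1 h2, ?_⟩
          have : (⟨y + z, add_mem h1 h2⟩ : S.carrier) = ⟨y, h1⟩ + ⟨z, h2⟩ := rfl
          rw [this, map_add, add_smul]
          exact add_mem h1' h2'
      exact (h x.1 (S.graded x.2)).2
    | zero => rw [smul_zero]; exact zero_mem _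
    | add y z _ _ hy hz => rw [smul_add]; exact add_mem hy hz)
  intro w hw
  obtain ⟨a, rfl⟩ := Submodule.mem_span_singleton.1 hw
  exact hst a v (Submodule.mem_iSup_of_mem k ⟨Submodule.mem_span_singleton_self v, hv⟩)

/-- A nonzero homogeneous vector generates a simple graded module. -/
theorem span_singleton_eq_top {S : RestrictedSub F m n p} {V : Type*} [AddCommGroup V]
    [Module F V] [Module (RedEnv S χ) V] [IsScalarTower F (RedEnv S χ) V]
    {gr : ZMod 2 → Submodule F V} (hgr : IsSuperModule S χ gr)
    (hs : IsSimpleSuper (RedEnv S χ) gr) {k : ZMod 2} {v : V} (hv : v ∈ gr k) (h0 : v ≠ 0) :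
    Submodule.span (RedEnv S χ) {v} = ⊤ := by
  refine (hs.2 _ (span_singleton_graded χ S hgr.smul_mem hv)).resolve_left fun h => h0 ?_
  rwa [Submodule.span_singleton_eq_bot] at h

theorem homPart_ι_mul (S : RestrictedSub F m n p) {i j : ZMod 2} {x : S.carrier}
    (hx : x.1 ∈ part F m n i) {a : RedEnv S χ} (ha : a ∈ RedEnv.homPart S χ j) :
    RedEnv.ι S χ x * a ∈ RedEnv.homPart S χ (i + j) := by
  induction ha using Submodule.span_induction with
  | mem a ha => exact Submodule.subset_span (.mul i j x hx a ha)
  | zero => rw [mul_zero]; exact zero_mem _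
  | add a b _ _ ha hb => rw [mul_add]; exact add_mem ha hb
  | smul c a _ ha => rw [mul_smul_comm]; exact Submodule.smul_mem _ _ ha

variable {M : Type*} [AddCommGroup M] [Module F M] [Module (RedEnv (glEven F m n p) χ) M]
  {gr : ZMod 2 → Submodule F M}

theorem verma_mem_grading {k : ZMod 2} {w : M} (hw : w ∈ gr k) :
    verma (p := p) χ w ∈ gradedBabyVerma.grading (p := p) χ gr k :=
  Submodule.subset_span ⟨0, k, 1, w, zero_add k, Submodule.subset_span .one, hw, rfl⟩

theorem ι_smul_mem_grading (i j : ZMod 2) (x : (glFull F m n p).carrier)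
    (hx : x.1 ∈ part F m n i) (z : gradedBabyVerma (p := p) χ M)
    (hz : z ∈ gradedBabyVerma.grading χ gr j) :
    RedEnv.ι (glFull F m n p) χ x • z ∈ gradedBabyVerma.grading χ gr (i + j) := by
  induction hz using Submodule.span_induction with
  | mem z hz =>
    obtain ⟨j', k, a, w, rfl, ha, hw, rfl⟩ := hz
    refine Submodule.subset_span ⟨i + j', k, RedEnv.ι (glFull F m n p) χ x * a, w,
      add_assoc _ _ _, homPart_ι_mul χ _ hx ha, hw, ?_⟩
    rw [tmul_eq_smul_verma, tmul_eq_smul_verma, mul_smul]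
  | zero => rw [smul_zero]; exact zero_mem _
  | add a b _ _ ha hb => rw [smul_add]; exact add_mem ha hb
  | smul c a _ ha => rw [smul_comm]; exact Submodule.smul_mem _ _ ha

end Graded

/-! ### Odd root vectors in `u(𝔤, χ)`. -/

section RootVectors

variable {F : Type*} [Field F] {m n p : ℕ} (χ : Module.Dual F (part F m n 0))

/-- This is where characteristic different from `2` enters: anticommutation of an odd root vector
with itself then gives square zero. -/
theorem eq_zero_of_add_self {U : Type*} [Ring U] [Algebra F U] (h2 : (2 : F) ≠ 0) {x : U}
    (h : x + x = 0) : x = 0 := by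
  have h1 : (2 : F) • x = 0 := by rw [two_smul, h]
  exact (smul_eq_zero_iff_right h2).1 h1

theorem oddNeg_anticomm (a b : Fin m × Fin n) :
    oddNeg (p := p) χ a * oddNeg χ b = -(oddNeg χ b * oddNeg χ a) := by
  simp only [oddNeg_eq]
  exact eq_neg_of_add_eq_zero_left ((envBlockRelations χ).down_down _ _)

theorem oddPos_anticomm (a b : Fin m × Fin n) :
    oddPos (p := p) χ a * oddPos χ b = -(oddPos χ b * oddPos χ a) := by
  simp only [oddPos_eq]
  exact eq_neg_of_add_eq_zero_left ((envBlockRelations χ).up_up _ _)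

theorem oddNeg_sq (h2 : (2 : F) ≠ 0) (a : Fin m × Fin n) :
    oddNeg (p := p) χ a * oddNeg χ a = 0 :=
  eq_zero_of_add_self h2 (add_eq_zero_iff_eq_neg.2 (oddNeg_anticomm χ a a))

theorem oddPos_sq (h2 : (2 : F) ≠ 0) (a : Fin m × Fin n) :
    oddPos (p := p) χ a * oddPos χ a = 0 :=
  eq_zero_of_add_self h2 (add_eq_zero_iff_eq_neg.2 (oddPos_anticomm χ a a))

theorem envDown_mem_span (c : Matrix (Fin n) (Fin m) F) :
    envDown (p := p) χ c ∈ Submodule.span F (Set.range (oddNeg (p := p) χ)) := by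
  rw [Matrix.matrix_eq_sum_single c, map_sum]
  refine sum_mem fun j _ => ?_
  rw [map_sum]
  refine sum_mem fun i _ => ?_
  have e : Matrix.single j i (c j i) = c j i • Matrix.single j i (1 : F) := by simp
  rw [e, map_smul]
  exact Submodule.smul_mem _ _ (Submodule.subset_span ⟨(i, j), oddNeg_eq χ (i, j)⟩)

theorem envUp_mem_span (b : Matrix (Fin m) (Fin n) F) :
    envUp (p := p) χ b ∈ Submodule.span F (Set.range (oddPos (p := p) χ)) := by
  rw [Matrix.matrix_eq_sum_single b, map_sum]
  refine sum_mem fun i _ => ?_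
  rw [map_sum]
  refine sum_mem fun j _ => ?_
  have e : Matrix.single i j (b i j) = b i j • Matrix.single i j (1 : F) := by simp
  rw [e, map_smul]
  exact Submodule.smul_mem _ _ (Submodule.subset_span ⟨(i, j), oddPos_eq χ (i, j)⟩)

theorem commutator_oddNeg_mem (x : DiagBlocks F m n) (a : Fin m × Fin n) :
    envDiag (p := p) χ x * oddNeg χ a - oddNeg χ a * envDiag χ x
      ∈ Submodule.span F (Set.range (oddNeg (p := p) χ)) := by
  rw [oddNeg_eq, (envBlockRelations χ).diag_down]
  exact envDown_mem_span χ _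

theorem commutator_oddPos_mem (x : DiagBlocks F m n) (a : Fin m × Fin n) :
    envDiag (p := p) χ x * oddPos χ a - oddPos χ a * envDiag χ x
      ∈ Submodule.span F (Set.range (oddPos (p := p) χ)) := by
  rw [oddPos_eq, (envBlockRelations χ).diag_up]
  exact envUp_mem_span χ _

theorem exists_envDiag_mul_oddNeg_prod (h2 : (2 : F) ≠ 0) (t : Fin (m * n) ≃ Fin m × Fin n)
    (x : DiagBlocks F m n) :
    ∃ c : F, envDiag (p := p) χ x * (List.ofFn fun k => oddNeg χ (t k)).prod
      = (List.ofFn fun k => oddNeg χ (t k)).prod * envDiag χ x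
        + c • (List.ofFn fun k => oddNeg χ (t k)).prod := by
  have h := exists_mul_top_eq (oddNeg_anticomm (p := p) χ) (oddNeg_sq χ h2) t
    (commutator_oddNeg_mem χ x)
  rwa [List.map_ofFn] at h

theorem exists_envDiag_mul_oddPos_prod (h2 : (2 : F) ≠ 0) (t : Fin (m * n) ≃ Fin m × Fin n)
    (x : DiagBlocks F m n) :
    ∃ c : F, envDiag (p := p) χ x * (List.ofFn fun k => oddPos χ (t k)).prod
      = (List.ofFn fun k => oddPos χ (t k)).prod * envDiag χ x
        + c • (List.ofFn fun k => oddPos χ (t k)).prod := by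
  have h := exists_mul_top_eq (oddPos_anticomm (p := p) χ) (oddPos_sq χ h2) t
    (commutator_oddPos_mem χ x)
  rwa [List.map_ofFn] at h

end RootVectors

/-! ### Counting odd negative letters in `Z^χ(M)`. -/

section Words

variable {F : Type*} [Field F] {m n p : ℕ} (χ : Module.Dual F (part F m n 0))
  {M : Type*} [AddCommGroup M] [Module F M] [Module (RedEnv (glEven F m n p) χ) M]

/-- The span of the products of `r` odd negative root vectors applied to vectors `1 ⊗ w`, `w` in
the subspace `W`. -/
def negWords (W : Submodule F M) (r : ℕ) : Submodule F (gradedBabyVerma (p := p) χ M) :=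
  Submodule.span F {z | ∃ (K : List (Fin m × Fin n)) (w : M), K.length = r ∧ w ∈ W ∧
    z = (K.map (oddNeg (p := p) χ)).prod • verma (p := p) χ w}

variable {χ}

theorem oddNeg_smul_mem_negWords {W : Submodule F M} {r : ℕ} (a : Fin m × Fin n)
    {z : gradedBabyVerma (p := p) χ M} (hz : z ∈ negWords (p := p) χ W r) :
    oddNeg (p := p) χ a • z ∈ negWords (p := p) χ W (r + 1) := by
  induction hz using Submodule.span_induction with
  | mem z hz =>
    obtain ⟨K, w, rfl, hw, rfl⟩ := hz
    exact Submodule.subset_span ⟨a :: K, w, rfl, hw, by simp [mul_smul]⟩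
  | zero => rw [smul_zero]; exact zero_mem _
  | add a b _ _ ha hb => rw [smul_add]; exact add_mem ha hb
  | smul c a _ ha => rw [smul_comm]; exact Submodule.smul_mem _ _ ha

theorem envDown_smul_mem_negWords {W : Submodule F M} {r : ℕ} (c : Matrix (Fin n) (Fin m) F)
    {z : gradedBabyVerma (p := p) χ M} (hz : z ∈ negWords (p := p) χ W r) :
    envDown (p := p) χ c • z ∈ negWords (p := p) χ W (r + 1) :=
  smul_mem_of_mem_span_range (envDown_mem_span χ c) fun a => oddNeg_smul_mem_negWords a hz

theorem familyPow_smul_mem_negWords {W : Submodule F M} {r : ℕ}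
    {a : RedEnv (glFull F m n p) χ} (ha : a ∈ familyPow F (oddNeg (p := p) χ) r) {w : M} (hw : w ∈ W) :
    a • verma (p := p) χ w ∈ negWords (p := p) χ W r := by
  induction ha using Submodule.span_induction with
  | mem a ha =>
    obtain ⟨K, hK, rfl⟩ := ha
    exact Submodule.subset_span ⟨K, w, hK, hw, rfl⟩
  | zero => rw [zero_smul]; exact zero_mem _
  | add a b _ _ ha hb => rw [add_smul]; exact add_mem ha hb
  | smul c a _ ha => rw [smul_assoc]; exact Submodule.smul_mem _ _ ha

/-- Since `𝔤₀` normalizes `𝔤₋₁`, moving `x` through a word gives words of the same length, and `x`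
finally acts on `w` inside `W`. -/
theorem envDiag_smul_mem_negWords {W : Submodule F M} {r : ℕ}
    (hW : ∀ x, ∀ w ∈ W, evenDiag (p := p) χ x • w ∈ W) (x : DiagBlocks F m n)
    {z : gradedBabyVerma (p := p) χ M} (hz : z ∈ negWords (p := p) χ W r) :
    envDiag (p := p) χ x • z ∈ negWords (p := p) χ W r := by
  induction hz using Submodule.span_induction with
  | mem z hz =>
    obtain ⟨K, w, rfl, hw, rfl⟩ := hz
    have h := commutator_prod_mem_familyPow (commutator_oddNeg_mem (p := p) χ x) K
    have e : envDiag (p := p) χ x • (K.map (oddNeg (p := p) χ)).prod • verma (p := p) χ w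
        = (envDiag (p := p) χ x * (K.map (oddNeg (p := p) χ)).prod - (K.map (oddNeg (p := p) χ)).prod * envDiag (p := p) χ x)
            • verma (p := p) χ w
          + (K.map (oddNeg (p := p) χ)).prod • verma (p := p) χ (evenDiag (p := p) χ x • w) := by
      rw [← envDiag_smul_verma, sub_smul, mul_smul, mul_smul, sub_add_cancel]
    rw [e]
    exact add_mem (familyPow_smul_mem_negWords h hw)
      (Submodule.subset_span ⟨K, _, rfl, hW x w hw, rfl⟩)
  | zero => rw [smul_zero]; exact zero_mem _
  | add a b _ _ ha hb => rw [smul_add]; exact add_mem ha hb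
  | smul c a _ ha => rw [smul_comm]; exact Submodule.smul_mem _ _ ha

/-- An element of `𝔤₁` removes one letter: its anticommutator with a letter is even and keeps the
length of the remaining word, and on reaching `1 ⊗ w` it gives zero. The empty word is stated apart
to avoid truncated subtraction of lengths. -/
theorem envUp_smul_prod_smul_verma {W : Submodule F M}
    (hW : ∀ x, ∀ w ∈ W, evenDiag (p := p) χ x • w ∈ W) (b : Matrix (Fin m) (Fin n) F)
    (K : List (Fin m × Fin n)) {w : M} (hw : w ∈ W) :
    (∀ r, K.length = r + 1 →
      envUp (p := p) χ b • (K.map (oddNeg (p := p) χ)).prod • verma (p := p) χ w ∈ negWords (p := p) χ W r) ∧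
    (K.length = 0 → envUp (p := p) χ b • (K.map (oddNeg (p := p) χ)).prod • verma (p := p) χ w = 0) := by
  induction K with
  | nil => simp [envUp_smul_verma]
  | cons a K ih =>
    refine ⟨fun r hr => ?_, by simp⟩
    have hr' : K.length = r := by simpa using hr
    have e : envUp (p := p) χ b * oddNeg (p := p) χ a
        = envDiag (p := p) χ (b * Matrix.single a.2 a.1 (1 : F),
            Matrix.single a.2 a.1 (1 : F) * b)
          - oddNeg (p := p) χ a * envUp (p := p) χ b := by
      rw [oddNeg_eq, ← (envBlockRelations χ).up_down, add_sub_cancel_right]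
    rw [List.map_cons, List.prod_cons, mul_smul, ← mul_smul, e, sub_smul, mul_smul]
    refine sub_mem (envDiag_smul_mem_negWords hW _ (Submodule.subset_span ⟨K, w, hr', hw, rfl⟩))
      ?_
    cases r with
    | zero => rw [ih.2 hr', smul_zero]; exact zero_mem _
    | succ r => exact oddNeg_smul_mem_negWords a (ih.1 r hr')

theorem envUp_smul_mem_negWords {W : Submodule F M} {r : ℕ}
    (hW : ∀ x, ∀ w ∈ W, evenDiag (p := p) χ x • w ∈ W) (b : Matrix (Fin m) (Fin n) F)
    {z : gradedBabyVerma (p := p) χ M} (hz : z ∈ negWords (p := p) χ W (r + 1)) :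
    envUp (p := p) χ b • z ∈ negWords (p := p) χ W r := by
  induction hz using Submodule.span_induction with
  | mem z hz =>
    obtain ⟨K, w, hK, hw, rfl⟩ := hz
    exact (envUp_smul_prod_smul_verma hW b K hw).1 r hK
  | zero => rw [smul_zero]; exact zero_mem _
  | add a b _ _ ha hb => rw [smul_add]; exact add_mem ha hb
  | smul c a _ ha => rw [smul_comm]; exact Submodule.smul_mem _ _ ha

theorem envUp_smul_eq_zero_of_mem_negWords {W : Submodule F M} (b : Matrix (Fin m) (Fin n) F)
    {z : gradedBabyVerma (p := p) χ M} (hz : z ∈ negWords (p := p) χ W 0) : envUp (p := p) χ b • z = 0 := by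
  induction hz using Submodule.span_induction with
  | mem z hz =>
    obtain ⟨K, w, hK, hw, rfl⟩ := hz
    rw [List.length_eq_zero_iff.1 hK, List.map_nil, List.prod_nil, one_smul, envUp_smul_verma]
  | zero => rw [smul_zero]
  | add a b _ _ ha hb => rw [smul_add, ha, hb, add_zero]
  | smul c a _ ha => rw [smul_comm, ha, smul_zero]

theorem oddPos_prod_smul_mem_negWords {W : Submodule F M}
    (hW : ∀ x, ∀ w ∈ W, evenDiag (p := p) χ x • w ∈ W) (J : List (Fin m × Fin n)) (q : ℕ)
    {z : gradedBabyVerma (p := p) χ M} (hz : z ∈ negWords (p := p) χ W (J.length + q)) :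
    (J.map (oddPos (p := p) χ)).prod • z ∈ negWords (p := p) χ W q := by
  induction J generalizing q with
  | nil => simpa using hz
  | cons a J ih =>
    rw [List.map_cons, List.prod_cons, mul_smul, oddPos_eq]
    refine envUp_smul_mem_negWords hW _ (ih (q + 1) ?_)
    rwa [List.length_cons, add_assoc, add_comm 1 q] at hz

variable (χ) in
/-- The part of `Z^χ(M)` of degree `i`, spanned by words in the odd negative root vectors. -/
def negWordsPart (gr : ZMod 2 → Submodule F M) (i : ZMod 2) :
    Submodule F (gradedBabyVerma (p := p) χ M) :=
  ⨆ (r : ℕ) (k : ZMod 2) (_ : (r : ZMod 2) + k = i), negWords (p := p) χ (gr k) r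

theorem negWords_le_negWordsPart {gr : ZMod 2 → Submodule F M} {i : ZMod 2} (r : ℕ) (k : ZMod 2)
    (h : (r : ZMod 2) + k = i) : negWords (p := p) χ (gr k) r ≤ negWordsPart (p := p) χ gr i :=
  le_iSup_of_le r (le_iSup_of_le k (le_iSup_of_le h le_rfl))

theorem smul_mem_negWordsPart_of {gr : ZMod 2 → Submodule F M} {i j : ZMod 2}
    {x : RedEnv (glFull F m n p) χ}
    (h : ∀ (r : ℕ) (k : ZMod 2), (r : ZMod 2) + k = i →
      ∀ z ∈ negWords (p := p) χ (gr k) r,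
      x • z ∈ negWordsPart (p := p) χ gr j) {z : gradedBabyVerma (p := p) χ M}
    (hz : z ∈ negWordsPart (p := p) χ gr i) : x • z ∈ negWordsPart (p := p) χ gr j := by
  have hle : negWordsPart (p := p) χ gr i
      ≤ (negWordsPart (p := p) χ gr j).comap (Algebra.lsmul F F (gradedBabyVerma (p := p) χ M) x) :=
    iSup_le fun r => iSup_le fun k => iSup_le fun hk => fun z hz => h r k hk z hz
  exact hle hz

theorem ι_smul_mem_negWordsPart {gr : ZMod 2 → Submodule F M}
    (hW : ∀ k x, ∀ w ∈ gr k, evenDiag (p := p) χ x • w ∈ gr k) {i j : ZMod 2}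
    (x : (glFull F m n p).carrier) (hx : x.1 ∈ part F m n i)
    {z : gradedBabyVerma (p := p) χ M} (hz : z ∈ negWordsPart (p := p) χ gr j) :
    RedEnv.ι (glFull F m n p) χ x • z ∈ negWordsPart (p := p) χ gr (i + j) := by
  rw [envι_eq]
  rcases zmod_two_cases i with rfl | rfl
  · rw [upOf_of_even hx, downOf_of_even hx, map_zero, map_zero, add_zero, add_zero, zero_add]
    exact smul_mem_negWordsPart_of (fun r k hk z hz => negWords_le_negWordsPart r k hk
      (envDiag_smul_mem_negWords (hW k) _ hz)) hz
  · rw [diagOf_of_odd hx, map_zero, zero_add, add_smul]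
    refine add_mem (smul_mem_negWordsPart_of (fun r k hk z hz => ?_) hz)
      (smul_mem_negWordsPart_of (fun r k hk z hz => negWords_le_negWordsPart (r + 1) k
        (by rw [← hk]; push_cast; ring) (envDown_smul_mem_negWords _ hz)) hz)
    cases r with
    | zero => rw [envUp_smul_eq_zero_of_mem_negWords _ hz]; exact zero_mem _
    | succ r =>
      refine negWords_le_negWordsPart r k ?_ (envUp_smul_mem_negWords (hW k) _ hz)
      -- Removing a letter and adding one change the parity in the same way.
      have h2 : (2 : ZMod 2) = 0 := by decide
      rw [← hk]
      push_cast
      linear_combination (-1 : ZMod 2) * h2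

/-- Every homogeneous monomial acts on `1 ⊗ w` one generator at a time, and each generator shifts
the parity of a word as it should. -/
theorem grading_le_negWordsPart {gr : ZMod 2 → Submodule F M}
    (hW : ∀ k x, ∀ w ∈ gr k, evenDiag (p := p) χ x • w ∈ gr k) (i : ZMod 2) :
    gradedBabyVerma.grading (p := p) χ gr i ≤ negWordsPart (p := p) χ gr i := by
  refine Submodule.span_le.2 ?_
  rintro _ ⟨j, k, a, w, rfl, ha, hw, rfl⟩
  rw [tmul_eq_smul_verma]
  change a • verma (p := p) χ w ∈ negWordsPart (p := p) χ gr (j + k)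
  induction ha using Submodule.span_induction with
  | mem a ha =>
    induction ha with
    | one =>
      exact negWords_le_negWordsPart 0 k (by simp) (Submodule.subset_span ⟨[], w, rfl, hw, by simp⟩)
    | mul i j x hx a _ ih =>
      rw [mul_smul, add_assoc]
      exact ι_smul_mem_negWordsPart hW x hx ih
  | zero => rw [zero_smul]; exact zero_mem _
  | add a b _ _ ha hb => rw [add_smul]; exact add_mem ha hb
  | smul c a _ ha => rw [smul_assoc]; exact Submodule.smul_mem _ _ ha

/-- The degree `i` part of `Z^χ(M)` is spanned by ordered words in the odd negative root
vectors. -/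
theorem grading_le_sublistSpan (h2 : (2 : F) ≠ 0) {gr : ZMod 2 → Submodule F M}
    (hW : ∀ k x, ∀ w ∈ gr k, evenDiag (p := p) χ x • w ∈ gr k) {L : List (Fin m × Fin n)}
    (hL : ∀ a, a ∈ L) (i : ZMod 2) :
    gradedBabyVerma.grading (p := p) χ gr i
      ≤ sublistSpan (oddNeg (p := p) χ) (fun k => (gr k).map (verma (p := p) χ)) L i := by
  refine (grading_le_negWordsPart hW i).trans (iSup_le fun r => iSup_le fun k => iSup_le fun hk => ?_)
  refine Submodule.span_le.2 ?_
  rintro _ ⟨K, w, rfl, hw, rfl⟩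
  have := prod_smul_mem_sublistSpan (G := fun k => (gr k).map (verma (p := p) χ))
    (oddNeg_anticomm (p := p) χ) (oddNeg_sq χ h2) hL K
    (Submodule.mem_map_of_mem hw)
  rwa [hk] at this

end Words

/-! ### The simplicity criterion. -/

section Simplicity

variable {F : Type*} [Field F] {m n p : ℕ} (χ : Module.Dual F (part F m n 0))
  {M : Type*} [AddCommGroup M] [Module F M] [Module (RedEnv (glEven F m n p) χ) M]
  {gr : ZMod 2 → Submodule F M}

theorem evenDiag_smul_mem_of_isSuperModule (hgr : IsSuperModule (glEven F m n p) χ gr)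
    (k : ZMod 2) (x : DiagBlocks F m n) (w : M) (hw : w ∈ gr k) :
    evenDiag (p := p) χ x • w ∈ gr k := by
  have := hgr.smul_mem 0 k ⟨diagMat F m n x, diagMat_mem x⟩ (diagMat_mem x) w hw
  rwa [zero_add] at this

theorem oddNeg_list_prod_smul_mem_grading (L : List (Fin m × Fin n)) {k : ZMod 2}
    {z : gradedBabyVerma (p := p) χ M} (hz : z ∈ gradedBabyVerma.grading (p := p) χ gr k) :
    ∃ j, (L.map (oddNeg (p := p) χ)).prod • z ∈ gradedBabyVerma.grading (p := p) χ gr j := by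
  induction L with
  | nil => exact ⟨k, by simpa using hz⟩
  | cons a L ih =>
    obtain ⟨j, hj⟩ := ih
    refine ⟨1 + j, ?_⟩
    rw [List.map_cons, List.prod_cons, mul_smul, oddNeg_eq]
    exact ι_smul_mem_grading χ 1 j _ (downMat_mem _) _ hj

/-- The submodule generated by `f₁ ⋯ f_l ⊗ v` is spanned by words in the odd positive root vectors
applied to `f₁ ⋯ f_l ⊗ M`. -/
theorem smul_mem_span_oddPos_words (h2 : (2 : F) ≠ 0) (t : Fin (m * n) ≃ Fin m × Fin n)
    (a : RedEnv (glFull F m n p) χ) (v : M) :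
    a • (List.ofFn fun k => oddNeg (p := p) χ (t k)).prod • verma (p := p) χ v
      ∈ Submodule.span F {z | ∃ (J : List (Fin m × Fin n)) (w : M),
        z = (J.map (oddPos (p := p) χ)).prod •
          (List.ofFn fun k => oddNeg (p := p) χ (t k)).prod • verma (p := p) χ w} := by
  set Φ := (List.ofFn fun k => oddNeg (p := p) χ (t k)).prod with hΦ
  set W := Submodule.span F {z | ∃ (J : List (Fin m × Fin n)) (w : M),
    z = (J.map (oddPos (p := p) χ)).prod • Φ • verma (p := p) χ w} with hW
  have hbase : ∀ (J : List (Fin m × Fin n)) (w : M),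
      (J.map (oddPos (p := p) χ)).prod • Φ • verma (p := p) χ w ∈ W := fun J w =>
    Submodule.subset_span ⟨J, w, rfl⟩
  have hspan : ∀ x : RedEnv (glFull F m n p) χ,
      (∀ (J : List (Fin m × Fin n)) (w : M),
        x • (J.map (oddPos (p := p) χ)).prod • Φ • verma (p := p) χ w ∈ W) →
      ∀ z ∈ W, x • z ∈ W := by
    intro x hx
    have hle : W ≤ W.comap (Algebra.lsmul F F (gradedBabyVerma (p := p) χ M) x) := by
      refine Submodule.span_le.2 ?_
      rintro _ ⟨J, w, rfl⟩
      exact hx J w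
    exact fun z hz => hle hz
  have hup : ∀ a, ∀ z ∈ W, oddPos (p := p) χ a • z ∈ W := fun a => hspan _ fun J w => by
    have := hbase (a :: J) w
    rwa [List.map_cons, List.prod_cons, mul_smul] at this
  have hpow : ∀ (r : ℕ) (b : RedEnv (glFull F m n p) χ), b ∈ familyPow F (oddPos (p := p) χ) r →
      ∀ w : M, b • Φ • verma (p := p) χ w ∈ W := by
    intro r b hb w
    induction hb using Submodule.span_induction with
    | mem b hb => obtain ⟨J, -, rfl⟩ := hb; exact hbase J w
    | zero => rw [zero_smul]; exact zero_mem _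
    | add a b _ _ ha hb => rw [add_smul]; exact add_mem ha hb
    | smul c a _ ha => rw [smul_assoc]; exact Submodule.smul_mem _ _ ha
  -- Moving `x` through the word in the `e`'s gives words of the same kind, moving it through `Φ`
  -- costs a multiple of `Φ`, and then `x` acts on `w`.
  have hdiag : ∀ x, ∀ z ∈ W, envDiag (p := p) χ x • z ∈ W := fun x => hspan _ fun J w => by
    obtain ⟨c, hc⟩ := exists_envDiag_mul_oddNeg_prod (p := p) χ h2 t x
    rw [← hΦ] at hc
    have h := hpow _ _ (commutator_prod_mem_familyPow (commutator_oddPos_mem (p := p) χ x) J) w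
    rw [sub_smul, mul_smul, mul_smul, ← mul_smul (envDiag (p := p) χ x) Φ, hc, add_smul, mul_smul Φ,
      envDiag_smul_verma, smul_add, smul_assoc c, smul_comm _ c] at h
    exact (Submodule.sub_mem_iff_left W
      (add_mem (hbase _ _) (W.smul_mem c (hbase _ _)))).1 h
  -- At the empty word `f_b Φ = 0`, because `f_b` already occurs in `Φ`. Passing a letter `e_a`
  -- costs an even element, which `hdiag` handles.
  have hdown : ∀ b, ∀ z ∈ W, oddNeg (p := p) χ b • z ∈ W := fun b => hspan _ fun J w => by
    induction J with
    | nil =>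
      have h := mul_prod_eq_zero (oddNeg_anticomm (p := p) χ) (oddNeg_sq χ h2)
        (List.mem_ofFn.2 (t.surjective b))
      rw [List.map_ofFn] at h
      rw [List.map_nil, List.prod_nil, one_smul, ← mul_smul]
      change (oddNeg (p := p) χ b * (List.ofFn (oddNeg (p := p) χ ∘ t)).prod) • _ ∈ W
      rw [h, zero_smul]
      exact zero_mem _
    | cons a J ih =>
      have e : ∃ y, oddNeg (p := p) χ b * oddPos χ a
          = envDiag χ y - oddPos χ a * oddNeg χ b :=
        ⟨_, by rw [oddNeg_eq, oddPos_eq, ← (envBlockRelations χ).up_down, add_sub_cancel_left]⟩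
      obtain ⟨y, e⟩ := e
      rw [List.map_cons, List.prod_cons, mul_smul, ← mul_smul, e, sub_smul, mul_smul]
      exact sub_mem (hdiag y _ (hbase J w)) (hup a _ ih)
  refine smul_mem_of_blocks χ W hdiag (fun b z hz => ?_) (fun c z hz => ?_) a _ ?_
  · exact smul_mem_of_mem_span_range (envUp_mem_span χ b) fun a => hup a z hz
  · exact smul_mem_of_mem_span_range (envDown_mem_span χ c) fun a => hdown a z hz
  · simpa using hbase [] v

variable [IsScalarTower F (RedEnv (glEven F m n p) χ) M]

/-- A `𝔤₀`-stable subspace of a simple module that contains a nonzero homogeneous vector is the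
whole module. -/
theorem mem_of_evenDiag_stable (hgr : IsSuperModule (glEven F m n p) χ gr)
    (hs : IsSimpleSuper (RedEnv (glEven F m n p) χ) gr) {W : Submodule F M}
    (hW : ∀ x, ∀ w ∈ W, evenDiag (p := p) χ x • w ∈ W) {k : ZMod 2} {v : M} (hv : v ∈ gr k)
    (h0 : v ≠ 0) (hvW : v ∈ W) (w : M) : w ∈ W := by
  have h : w ∈ Submodule.span (RedEnv (glEven F m n p) χ) {v} := by
    rw [span_singleton_eq_top χ hgr hs hv h0]; trivial
  obtain ⟨a, rfl⟩ := Submodule.mem_span_singleton.1 h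
  exact even_smul_mem_of_diag χ W hW a v hvW

/-- The vectors `w` for which `f₁ ⋯ f_l ⊗ w` lies in a submodule form a `𝔤₀`-stable subspace. -/
theorem oddNeg_prod_smul_verma_mem (h2 : (2 : F) ≠ 0) (t : Fin (m * n) ≃ Fin m × Fin n)
    (hgr : IsSuperModule (glEven F m n p) χ gr)
    (hs : IsSimpleSuper (RedEnv (glEven F m n p) χ) gr)
    (N : Submodule (RedEnv (glFull F m n p) χ) (gradedBabyVerma (p := p) χ M))
    {k : ZMod 2} {v : M} (hv : v ∈ gr k) (h0 : v ≠ 0)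
    (hN : (List.ofFn fun k => oddNeg (p := p) χ (t k)).prod • verma (p := p) χ v ∈ N) (w : M) :
    (List.ofFn fun k => oddNeg (p := p) χ (t k)).prod • verma (p := p) χ w ∈ N := by
  let W : Submodule F M := (N.restrictScalars F).comap
    (Algebra.lsmul F F (gradedBabyVerma (p := p) χ M)
      (List.ofFn fun k => oddNeg (p := p) χ (t k)).prod ∘ₗ verma (p := p) χ)
  refine mem_of_evenDiag_stable χ hgr hs (W := W) (fun x w hw => ?_) hv h0 hN w
  change (List.ofFn fun k => oddNeg (p := p) χ (t k)).prod • verma (p := p) χ w ∈ N at hw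
  change (List.ofFn fun k => oddNeg (p := p) χ (t k)).prod •
    verma (p := p) χ (evenDiag (p := p) χ x • w) ∈ N
  obtain ⟨c, hc⟩ := exists_envDiag_mul_oddNeg_prod (p := p) χ h2 t x
  rw [← envDiag_smul_verma, ← mul_smul, ← sub_eq_iff_eq_add.2 hc, sub_smul, mul_smul, smul_assoc]
  exact sub_mem (N.smul_mem _ hw) ((N.restrictScalars F).smul_mem c hw)

/-- If `e₁ ⋯ e_l f₁ ⋯ f_l` acts on `1 ⊗ v` by a nonzero scalar, then `Z^χ(M)` is simple. -/
theorem isSimpleSuper_of_oddProd_smul [Fact p.Prime] [CharP F p] (h2 : (2 : F) ≠ 0)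
    (s t : Fin (m * n) ≃ Fin m × Fin n) (hgr : IsSuperModule (glEven F m n p) χ gr)
    (hs : IsSimpleSuper (RedEnv (glEven F m n p) χ) gr) {v : M} (h0 : v ≠ 0)
    (hv : ∃ i, v ∈ gr i) {c : F} (hc0 : c ≠ 0)
    (hc : oddProd (p := p) χ s t • verma (p := p) χ v = c • verma (p := p) χ v) :
    IsSimpleSuper (RedEnv (glFull F m n p) χ) (gradedBabyVerma.grading (p := p) χ gr) := by
  obtain ⟨i₀, hv⟩ := hv
  have hst := evenDiag_smul_mem_of_isSuperModule χ hgr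
  refine ⟨⟨verma (p := p) χ v, 0, fun h =>
    h0 (verma_injective χ (h.trans (map_zero _).symm))⟩, fun N hN => ?_⟩
  refine or_iff_not_imp_left.2 fun hbot => ?_
  -- A graded submodule without nonzero homogeneous vectors is zero.
  have hx : ∃ i, ∃ x ∈ N, x ∈ gradedBabyVerma.grading (p := p) χ gr i ∧ x ≠ 0 := by
    by_contra! hcon
    refine hbot ((Submodule.restrictScalars_eq_bot_iff F _ _).1 ?_)
    rw [hN, iSup_eq_bot]
    intro i
    rw [eq_bot_iff]
    rintro x ⟨h1, h2⟩
    exact hcon i x h1 h2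
  obtain ⟨i, x, hxN, hxi, hx0⟩ := hx
  have hxs := grading_le_sublistSpan h2 hst (L := List.ofFn t)
    (fun a => List.mem_ofFn.2 (t.surjective a)) i hxi
  obtain ⟨g, -, -, -, j, y, hy, hy0, hgy⟩ := exists_smul_eq_prod_smul
    (oddNeg_anticomm (p := p) χ) (oddNeg_sq χ h2) _ hxs hx0
  obtain ⟨w, hw, rfl⟩ := Submodule.mem_map.1 hy
  have hw0 : w ≠ 0 := by rintro rfl; exact hy0 (map_zero _)
  have h3 := N.smul_mem g hxN
  rw [hgy, List.map_ofFn] at h3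
  -- Simplicity of `M` replaces the uncontrolled vector `w` by the given `v`, on which `e₁ ⋯ e_l f₁
  -- ⋯ f_l` is known to act by `c`.
  have h4 := oddNeg_prod_smul_verma_mem χ h2 t hgr hs N hw hw0 h3 v
  have h5 := N.smul_mem (List.ofFn fun k => oddPos (p := p) χ (s k)).prod h4
  rw [← mul_smul] at h5
  change oddProd (p := p) χ s t • _ ∈ N at h5
  rw [hc] at h5
  have h6 : verma (p := p) χ v ∈ N := by
    have := (N.restrictScalars F).smul_mem c⁻¹ h5
    rwa [smul_smul, inv_mul_cancel₀ hc0, one_smul] at this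
  have h7 : ∀ w : M, verma (p := p) χ w ∈ N := fun w =>
    mem_of_evenDiag_stable χ hgr hs (W := (N.restrictScalars F).comap (verma (p := p) χ))
      (fun x w hw => by
        change verma (p := p) χ _ ∈ N
        rw [← envDiag_smul_verma]
        exact N.smul_mem _ hw) hv h0 h6 w
  refine (Submodule.eq_top_iff').2 fun z => ?_
  induction z using verma_induction with
  | zero => exact zero_mem _
  | smul a w => exact N.smul_mem a (h7 w)
  | add y z hy hz => exact add_mem hy hz

/-- If `e₁ ⋯ e_l f₁ ⋯ f_l` kills `1 ⊗ v`, it kills `1 ⊗ M`. -/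
theorem oddProd_smul_verma_eq_zero (h2 : (2 : F) ≠ 0)
    (s t : Fin (m * n) ≃ Fin m × Fin n) (hgr : IsSuperModule (glEven F m n p) χ gr)
    (hs : IsSimpleSuper (RedEnv (glEven F m n p) χ) gr) {k : ZMod 2} {v : M} (hv : v ∈ gr k)
    (h0 : v ≠ 0) (hc : oddProd (p := p) χ s t • verma (p := p) χ v = 0) (w : M) :
    oddProd (p := p) χ s t • verma (p := p) χ w = 0 := by
  let W : Submodule F M := LinearMap.ker
    (Algebra.lsmul F F (gradedBabyVerma (p := p) χ M) (oddProd (p := p) χ s t)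
      ∘ₗ verma (p := p) χ)
  refine mem_of_evenDiag_stable χ hgr hs (W := W) (fun x w hw => ?_) hv h0 hc w
  change oddProd (p := p) χ s t • verma (p := p) χ w = 0 at hw
  change oddProd (p := p) χ s t • verma (p := p) χ (evenDiag (p := p) χ x • w) = 0
  obtain ⟨c, hc⟩ := exists_envDiag_mul_oddNeg_prod (p := p) χ h2 t x
  obtain ⟨d, hd⟩ := exists_envDiag_mul_oddPos_prod (p := p) χ h2 s x
  -- Even elements commute with the product up to a scalar multiple of it, so the vectors it kills
  -- form a `𝔤₀`-stable subspace, whatever the value of `c + d`.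
  have e : oddProd (p := p) χ s t * envDiag χ x
      = envDiag χ x * oddProd χ s t - (c + d) • oddProd χ s t := by
    unfold oddProd
    rw [mul_assoc, ← sub_eq_iff_eq_add.2 hc, ← mul_assoc (envDiag χ x), hd, mul_sub, add_mul,
      mul_smul_comm, smul_mul_assoc, add_smul, mul_assoc _ (envDiag χ x)]
    abel
  rw [← envDiag_smul_verma, ← mul_smul, e, sub_smul, mul_smul, hw, smul_zero, smul_assoc, hw,
    smul_zero, sub_zero]

/-- If `e₁ ⋯ e_l f₁ ⋯ f_l` kills `1 ⊗ v`, then `Z^χ(M)` is not simple. -/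
theorem not_isSimpleSuper_of_oddProd_smul_eq_zero [Fact p.Prime] [CharP F p] (h2 : (2 : F) ≠ 0)
    (s t : Fin (m * n) ≃ Fin m × Fin n) (hgr : IsSuperModule (glEven F m n p) χ gr)
    (hs : IsSimpleSuper (RedEnv (glEven F m n p) χ) gr) {v : M} (h0 : v ≠ 0)
    (hv : ∃ i, v ∈ gr i) (hc : oddProd (p := p) χ s t • verma (p := p) χ v = 0) :
    ¬ IsSimpleSuper (RedEnv (glFull F m n p) χ) (gradedBabyVerma.grading (p := p) χ gr) := by
  intro hsimple
  obtain ⟨i₀, hv⟩ := hv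
  set Φ := (List.ofFn fun k => oddNeg (p := p) χ (t k)).prod with hΦ
  have hΦ' : Φ = ((List.ofFn t).map (oddNeg (p := p) χ)).prod := by rw [List.map_ofFn]; rfl
  obtain ⟨j, hj⟩ := oddNeg_list_prod_smul_mem_grading χ (List.ofFn t)
    (verma_mem_grading (p := p) χ hv)
  rw [← hΦ'] at hj
  obtain ⟨π, hπ1, hπ2⟩ := exists_verma_proj (p := p) (M := M) χ
  -- The submodule generated by `Φ ⊗ v` is graded. It is nonzero since `Φ` acts injectively on `1 ⊗
  -- M`; were it everything, it would contain `1 ⊗ v`, which the projection `π` excludes.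
  rcases hsimple.2 _ (span_singleton_graded χ _ (ι_smul_mem_grading χ) hj) with h | h
  · rw [Submodule.span_singleton_eq_bot] at h
    exact h0 (oddNeg_prod_smul_verma_injective χ t h)
  · have hmem : verma (p := p) χ v
        ∈ Submodule.span (RedEnv (glFull F m n p) χ) {Φ • verma (p := p) χ v} := by
      rw [h]; trivial
    obtain ⟨a, ha⟩ := Submodule.mem_span_singleton.1 hmem
    have h3 := smul_mem_span_oddPos_words χ h2 t a v
    rw [← hΦ, ha] at h3
    have hker : ∀ r, negWords (p := p) χ (⊤ : Submodule F M) (r + 1) ≤ LinearMap.ker π := by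
      intro r
      refine Submodule.span_le.2 ?_
      rintro _ ⟨K, w, hK, -, rfl⟩
      rcases K with _ | ⟨b, K⟩
      · simp at hK
      · change π _ = 0
        rw [List.map_cons, List.prod_cons, mul_smul, oddNeg_eq, hπ2]
    have hle : Submodule.span F {z | ∃ (J : List (Fin m × Fin n)) (w : M),
        z = (J.map (oddPos (p := p) χ)).prod • Φ • verma (p := p) χ w} ≤ LinearMap.ker π := by
      refine Submodule.span_le.2 ?_
      rintro _ ⟨J, w, rfl⟩
      have hw : Φ • verma (p := p) χ w ∈ negWords (p := p) χ (⊤ : Submodule F M) (m * n) :=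
        Submodule.subset_span ⟨List.ofFn t, w, by simp, trivial, by rw [hΦ']⟩
      -- A short word in the `e`'s leaves at least one `f`, which `π` kills; a word of length `l` is
      -- a multiple of `e₁ ⋯ e_l`, which kills `Φ ⊗ M`; a longer word is zero.
      rcases lt_trichotomy J.length (m * n) with hlt | heq | hgt
      · obtain ⟨q, hq⟩ := Nat.exists_eq_add_of_lt hlt
        rw [hq, add_assoc] at hw
        exact hker q (oddPos_prod_smul_mem_negWords (W := ⊤)
          (fun _ _ _ => Submodule.mem_top) J (q + 1) hw)
      · obtain ⟨c, hJ⟩ := Submodule.mem_span_singleton.1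
          (prod_mem_span_of_length_eq (F := F) (oddPos_anticomm (p := p) χ) (oddPos_sq χ h2) s heq)
        have h5 : ((List.ofFn s).map (oddPos (p := p) χ)).prod • Φ • verma (p := p) χ w = 0 := by
          rw [List.map_ofFn, ← mul_smul]
          exact oddProd_smul_verma_eq_zero χ h2 s t hgr hs hv h0 hc w
        change π _ = 0
        rw [← hJ, smul_assoc, h5, smul_zero, map_zero]
      · change π _ = 0
        rw [prod_eq_zero_of_lt_length (oddPos_anticomm (p := p) χ) (oddPos_sq χ h2) s hgt,
          zero_smul, map_zero]
    have h4 := hle h3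
    rw [LinearMap.mem_ker, hπ1] at h4
    exact h0 h4

end Simplicity


end

theorem proposition4p2 {F : Type*} [Field F] [IsAlgClosed F] (p : ℕ) [Fact p.Prime] (hp : 2 < p)
    [CharP F p] (m n : ℕ) (χ : Module.Dual F (part F m n 0))
    (hχ : ∀ x : part F m n 0, x.1 ∈ nilPlus F m n → χ x = 0)
    (s t : Fin (m * n) ≃ Fin m × Fin n) :
    ∃ f₁ : Module.Dual F (cartan F m n) → F,
      ∀ (M : Type*) [AddCommGroup M] [Module F M] [Module (RedEnv (glEven F m n p) χ) M]
        [IsScalarTower F (RedEnv (glEven F m n p) χ) M] (gr : ZMod 2 → Submodule F M),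
        IsSuperModule (glEven F m n p) χ gr →
        IsSimpleSuper (RedEnv (glEven F m n p) χ) gr →
        ∀ (wt : Module.Dual F (cartan F m n)) (v : M),
          IsMaximalVector (p := p) χ gr wt v →
          (∀ c : F, oddProd (p := p) χ s t • gradedBabyVerma.tmul (p := p) χ 1 v
              = c • gradedBabyVerma.tmul (p := p) χ 1 v ↔ c = f₁ wt) ∧
          (IsSimpleSuper (RedEnv (glFull F m n p) χ)
              (gradedBabyVerma.grading (p := p) χ gr) ↔ f₁ wt ≠ 0) := by
  have h2 : (2 : F) ≠ 0 := by
    intro h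
    have h3 : ((2 : ℕ) : F) = 0 := by exact_mod_cast h
    rw [CharP.cast_eq_zero_iff F p] at h3
    exact absurd (Nat.le_of_dvd two_pos h3) (by omega)
  -- The scalar is chosen from a congruence in `u(𝔤, χ)`, before `M` and `v` are introduced, so it
  -- can depend only on the weight.
  choose f₁ hf₁ using fun wt => exists_scalar_oddProd (p := p) χ s t wt
  refine ⟨f₁, fun M _ _ _ _ gr hgr hs wt v hv => ?_⟩
  have hc : oddProd (p := p) χ s t • verma (p := p) χ v = f₁ wt • verma (p := p) χ v := by
    have h := weightIdeal_smul_verma hv (hf₁ wt)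
    rwa [sub_smul, algebraMap_smul, sub_eq_zero] at h
  have hv0 : verma (p := p) χ v ≠ 0 := fun h =>
    hv.ne_zero (verma_injective χ (h.trans (map_zero _).symm))
  refine ⟨fun c => ?_, fun hsimple hzero => ?_, fun hne => ?_⟩
  · rw [← verma_apply, hc]
    exact ⟨fun h => (smul_left_injective F hv0 h).symm, fun h => by rw [h]⟩
  · refine not_isSimpleSuper_of_oddProd_smul_eq_zero χ h2 s t hgr hs hv.ne_zero hv.homogeneous ?_
      hsimple
    rw [hc, hzero, zero_smul]
  · exact isSimpleSuper_of_oddProd_smul χ h2 s t hgr hs hv.ne_zero hv.homogeneous hne hc
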